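/- Let $n\ge 1$. Let $\mathcal U_{nc}(n)$ be the universal unital $C^*$-algebra with generators $u_{ij}$ ($1\le i,j\le n$) subject to the relation that the matrix $(u_{ij})$ is unitary, and let $\mathcal V_n=\operatorname{span}\{1,u_{ij},u_{ij}^*: 1\le i,j\le n\}\subseteq\mathcal U_{nc}(n)$, an operator subsystem. Put $\Lambda_n^+=\{(i,j): 1\le i\le n<j\le 2n\}$, $\Lambda_n^-=\{(i,j): 1\le j\le n<i\le 2n\}$ and $\Lambda_n=\Lambda_n^+\cup\Lambda_n^-$. For operator systems $\mathcal S,\mathcal T$ (abstract operator systems: complex $*$-vector spaces with a matrix ordering and an Archimedean matrix order unit $1$), $\mathcal S\otimes_{\min}\mathcal T$ is the $*$-vector space $\mathcal S\otimes\mathcal T$ with order unit $1\otimes1$ in which $X\in M_m(\mathcal S\otimes\mathcal T)$ is positive iff $X=X^*$ and $(\varphi\otimes\psi)^{(m)}(X)\ge 0$ for all unital completely positive maps $\varphi:\mathcal S\to M_k$, $\psi:\mathcal T\to M_l$, $k,l\in\mathbb N$. And $\mathcal S\otimes_{\max}\mathcal T$ is the same $*$-vector space with the same order unit in which $X\in M_m(\mathcal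 S\otimes\mathcal T)$ is positive iff $X=X^*$ and for every $\varepsilon>0$ the element $X+\varepsilon 1$ is of the form $A(P\otimes Q)A^*$ with $P\in M_k(\mathcal S)_+$, $Q\in M_l(\mathcal T)_+$, and $A:\mathbb C^k\otimes\mathbb C^l\to\mathbb C^m$ linear. We write $\mathcal S\otimes_{\min}\mathcal T=\mathcal S\otimes_{\max}\mathcal T$ if the two have the same positive cones at all matrix levels, and call $\mathcal S$ $(\min,\max)$-nuclear if this holds for every operator system $\mathcal T$. An operator system $\mathcal S$ has property $\mathfrak V_n$ if, whenever $p\in\mathbb N$ and $S_{11},S_{ij}\in M_p(\mathcal S)$ $((i,j)\in\Lambda_n)$ satisfy $$1\otimes S_{11}+\sum_{(i,j)\in\Lambda_n^+}\tfrac1{2n}u_{i,j-n}\otimes S_{ij}+\sum_{(i,j)\in\Lambda_n^-}\tfrac1{2n}u_{j,i-n}^*\otimes S_{ij}\in(\mathcal U_{nc}(n)\otimes_{\min}M_p(\mathcal S))_+,$$ then for each $\varepsilon>0$ there is a positive matrix $R=(R_{ij})\in M_{2n}(M_p(\mathcal S))$ such that $R_{ij}=S_{ij}$ for all $(i,j)\in\Lambda_n$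 and $\sum_{i=1}^{2n}R_{ii}=2n(S_{11}+\varepsilon 1_{M_p(\mathcal S)})$. It has property $\mathfrak V$ if it has property $\mathfrak V_n$ for every $n\ge1$. Proposition. Let $\mathcal S$ be an operator system. For every $n\ge1$, $\mathcal S$ has property $\mathfrak V_n$ if and only if $\mathcal V_n\otimes_{\min}\mathcal S=\mathcal V_n\otimes_{\max}\mathcal S$. In particular, if $\mathcal S$ is $(\min,\max)$-nuclear, then $\mathcal S$ has property $\mathfrak V$. -/

import Mathlib

open scoped TensorProduct Kronecker ENNReal ComplexOrder

universe u v w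

set_option linter.unusedSectionVars false

noncomputable section

namespace OpSys

/-! ### Abstract operator systems -/

section Compress

variable {ι κ S : Type*} [Fintype ι] [AddCommGroup S] [Module ℂ S]

/-- For a scalar matrix `A` and a matrix `X` over `S`, the matrix `A^* X A` over `S`. -/
def compress (A : Matrix ι κ ℂ) (X : Matrix ι ι S) : Matrix κ κ S :=
  Matrix.of fun i j => ∑ k, ∑ l, (star (A k i) * A l j) • X k l

theorem compress_submatrix {ι' κ' : Type*} [Fintype ι'] (A : Matrix ι κ ℂ) (X : Matrix ι ι S)
    (e : ι ≃ ι') (f : κ ≃ κ') :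
    compress (A.submatrix e.symm f.symm) (X.submatrix e.symm e.symm) =
      (compress A X).submatrix f.symm f.symm := by
  ext i j
  simp only [compress, Matrix.submatrix_apply, Matrix.of_apply]
  rw [← Equiv.sum_comp e.symm (fun k => ∑ l, (star (A k (f.symm i)) * A l (f.symm j)) • X k l)]
  refine Finset.sum_congr rfl fun k _ => ?_
  rw [← Equiv.sum_comp e.symm
    (fun l => (star (A (e.symm k) (f.symm i)) * A l (f.symm j)) • X (e.symm k) l)]

theorem compress_one [DecidableEq ι] (X : Matrix ι ι S) : compress 1 X = X := by
  ext i j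
  simp [compress, Matrix.one_apply, apply_ite]

theorem comp_compress {p : Type*} [Fintype p] [DecidableEq p] (A : Matrix ι κ ℂ)
    (X : Matrix ι ι (Matrix p p S)) :
    Matrix.comp κ κ p p S (compress A X) =
      compress (A ⊗ₖ (1 : Matrix p p ℂ)) (Matrix.comp ι ι p p S X) := by
  ext ⟨i, a⟩ ⟨j, b⟩
  simp [compress, Fintype.sum_prod_type, Matrix.one_apply, Matrix.sum_apply, apply_ite]

end Compress

/-- The structure of an (abstract) operator system on the complex `*`-vector space `S`: a matrix
ordering `cone` together with an Archimedean matrix order unit `unit`. -/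
class OperatorSystem (S : Type u) [AddCommGroup S] [Module ℂ S] [StarAddMonoid S]
    [StarModule ℂ S] where
  /-- the cone `M_n(S)_+` -/
  cone : ∀ n : ℕ, Set (Matrix (Fin n) (Fin n) S)
  /-- the Archimedean matrix order unit -/
  unit : S
  conjTranspose_eq : ∀ {n : ℕ} {X : Matrix (Fin n) (Fin n) S}, X ∈ cone n → X.conjTranspose = X
  add_mem : ∀ {n : ℕ} {X Y : Matrix (Fin n) (Fin n) S}, X ∈ cone n → Y ∈ cone n → X + Y ∈ cone n
  smul_mem : ∀ {n : ℕ} {X : Matrix (Fin n) (Fin n) S} {t : ℝ}, 0 ≤ t → X ∈ cone n →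
    (t : ℂ) • X ∈ cone n
  compress_mem : ∀ {n m : ℕ} (A : Matrix (Fin n) (Fin m) ℂ) {X : Matrix (Fin n) (Fin n) S},
    X ∈ cone n → compress A X ∈ cone m
  eq_zero : ∀ {n : ℕ} {X : Matrix (Fin n) (Fin n) S}, X ∈ cone n → -X ∈ cone n → X = 0
  star_unit : star unit = unit
  exists_add_mem : ∀ {n : ℕ} (X : Matrix (Fin n) (Fin n) S), X.conjTranspose = X →
    ∃ r : ℝ, 0 < r ∧ X + (r : ℂ) • Matrix.diagonal (fun _ => unit) ∈ cone n
  archimedean : ∀ {n : ℕ} (X : Matrix (Fin n) (Fin n) S), X.conjTranspose = X →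
    (∀ r : ℝ, 0 < r → X + (r : ℂ) • Matrix.diagonal (fun _ => unit) ∈ cone n) → X ∈ cone n

open OperatorSystem

section Positivity

variable {S : Type*} [AddCommGroup S] [Module ℂ S] [StarAddMonoid S] [StarModule ℂ S]
  [OperatorSystem S]

/-- Positivity of a matrix over `S` indexed by an arbitrary finite type `ι`: after identifying `ι`
with some `Fin k`, the matrix lies in `M_k(S)_+`. -/
def IsPos {ι : Type*} (X : Matrix ι ι S) : Prop :=
  ∃ (k : ℕ) (e : ι ≃ Fin k), X.submatrix e.symm e.symm ∈ cone k

variable {ι κ : Type*} [Fintype ι] [Fintype κ]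

/-- Positivity does not depend on the enumeration of the index set. -/
theorem isPos_iff {X : Matrix ι ι S} {k : ℕ} (e : ι ≃ Fin k) :
    IsPos X ↔ X.submatrix e.symm e.symm ∈ cone k := by
  classical
  refine ⟨?_, fun h => ⟨k, e, h⟩⟩
  rintro ⟨k', e', h⟩
  have := compress_mem ((1 : Matrix ι ι ℂ).submatrix e'.symm e.symm) h
  rwa [compress_submatrix, compress_one] at this

theorem isPos_fin_iff {k : ℕ} {X : Matrix (Fin k) (Fin k) S} : IsPos X ↔ X ∈ cone k :=
  isPos_iff (Equiv.refl _)

theorem IsPos.conjTranspose_eq {X : Matrix ι ι S} (hX : IsPos X) : X.conjTranspose = X := by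
  obtain ⟨k, e, h⟩ := hX
  have := OperatorSystem.conjTranspose_eq h
  rw [Matrix.conjTranspose_submatrix] at this
  ext i j
  simpa using congrFun (congrFun this (e i)) (e j)

theorem IsPos.add {X Y : Matrix ι ι S} (hX : IsPos X) (hY : IsPos Y) : IsPos (X + Y) := by
  have e := Fintype.equivFin ι
  rw [isPos_iff e] at *
  exact add_mem hX hY

theorem IsPos.smul {X : Matrix ι ι S} {t : ℝ} (ht : 0 ≤ t) (hX : IsPos X) :
    IsPos ((t : ℂ) • X) := by
  have e := Fintype.equivFin ι
  rw [isPos_iff e] at *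
  exact smul_mem ht hX

theorem IsPos.compress {X : Matrix ι ι S} (hX : IsPos X) (A : Matrix ι κ ℂ) :
    IsPos (compress A X) := by
  have e := Fintype.equivFin ι
  have f := Fintype.equivFin κ
  rw [isPos_iff e] at hX
  rw [isPos_iff f, ← compress_submatrix A X e]
  exact compress_mem _ hX

theorem IsPos.eq_zero {X : Matrix ι ι S} (hX : IsPos X) (hX' : IsPos (-X)) : X = 0 := by
  have e := Fintype.equivFin ι
  rw [isPos_iff e] at *
  have := OperatorSystem.eq_zero hX hX'
  ext i j
  simpa using congrFun (congrFun this (e i)) (e j)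

theorem submatrix_add_smul_unit [DecidableEq ι] (X : Matrix ι ι S) (r : ℂ) {k : ℕ}
    (e : ι ≃ Fin k) :
    (X + r • Matrix.diagonal (fun _ => (unit : S))).submatrix e.symm e.symm =
      X.submatrix e.symm e.symm + r • Matrix.diagonal (fun _ => (unit : S)) := by
  ext i j
  simp [Matrix.diagonal_apply]

theorem exists_isPos_add [DecidableEq ι] (X : Matrix ι ι S) (hX : X.conjTranspose = X) :
    ∃ r : ℝ, 0 < r ∧ IsPos (X + (r : ℂ) • Matrix.diagonal (fun _ => (unit : S))) := by
  have e := Fintype.equivFin ι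
  obtain ⟨r, hr, h⟩ := exists_add_mem (X.submatrix e.symm e.symm)
    (by rw [Matrix.conjTranspose_submatrix, hX])
  refine ⟨r, hr, ?_⟩
  rwa [isPos_iff e, submatrix_add_smul_unit]

theorem isPos_of_forall_add [DecidableEq ι] (X : Matrix ι ι S) (hX : X.conjTranspose = X)
    (h : ∀ r : ℝ, 0 < r → IsPos (X + (r : ℂ) • Matrix.diagonal (fun _ => (unit : S)))) :
    IsPos X := by
  have e := Fintype.equivFin ι
  rw [isPos_iff e]
  refine archimedean _ (by rw [Matrix.conjTranspose_submatrix, hX]) fun r hr => ?_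
  have := h r hr
  rwa [isPos_iff e, submatrix_add_smul_unit] at this

end Positivity

/-! ### Matrices over an operator system -/

section MatrixSystem

variable {S : Type*} [AddCommGroup S] [Module ℂ S] [StarAddMonoid S] [StarModule ℂ S]
  [OperatorSystem S]

theorem conjTranspose_comp {ι p : Type*} (X : Matrix ι ι (Matrix p p S)) :
    (Matrix.comp ι ι p p S X).conjTranspose = Matrix.comp ι ι p p S X.conjTranspose := by
  ext ⟨i, a⟩ ⟨j, b⟩
  simp [Matrix.conjTranspose_apply, Matrix.star_apply]

theorem comp_add_smul_unit {ι p : Type*} [DecidableEq ι] [DecidableEq p]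
    (X : Matrix ι ι (Matrix p p S)) (r : ℂ) :
    Matrix.comp ι ι p p S
        (X + r • Matrix.diagonal (fun _ => Matrix.diagonal (fun _ => (unit : S)))) =
      Matrix.comp ι ι p p S X + r • Matrix.diagonal (fun _ => (unit : S)) := by
  rw [← Matrix.comp_diagonal_diagonal (fun _ _ => (unit : S))]
  rfl

/-- The operator system `M_p(S)`, with `M_n(M_p(S)) = M_{np}(S)`. -/
instance matrixSystem (p : ℕ) : OperatorSystem (Matrix (Fin p) (Fin p) S) where
  cone n := {X | IsPos (Matrix.comp (Fin n) (Fin n) (Fin p) (Fin p) S X)}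
  unit := Matrix.diagonal fun _ => unit
  conjTranspose_eq {n X} h := by
    have := IsPos.conjTranspose_eq h
    rw [conjTranspose_comp] at this
    exact (Matrix.comp _ _ _ _ S).injective this
  add_mem h h' := IsPos.add h h'
  smul_mem ht h := IsPos.smul ht h
  compress_mem A X h := by
    change IsPos _
    rw [comp_compress]
    exact IsPos.compress h _
  eq_zero h h' := by
    have := IsPos.eq_zero h h'
    exact (Matrix.comp _ _ _ _ S).injective this
  star_unit := by
    rw [Matrix.star_eq_conjTranspose, Matrix.diagonal_conjTranspose]
    congr 1
    funext i
    exact star_unit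
  exists_add_mem X hX := by
    obtain ⟨r, hr, h⟩ := exists_isPos_add (Matrix.comp _ _ _ _ S X)
      (by rw [conjTranspose_comp, hX])
    refine ⟨r, hr, ?_⟩
    change IsPos _
    rwa [comp_add_smul_unit]
  archimedean X hX h := by
    refine isPos_of_forall_add _ (by rw [conjTranspose_comp, hX]) fun r hr => ?_
    rw [← comp_add_smul_unit]
    exact h r hr

end MatrixSystem

/-! ### Operator subsystems -/

section Subsystem

variable {A : Type*} [AddCommGroup A] [Module ℂ A] [StarAddMonoid A] [StarModule ℂ A]

/-- The involution of a self-adjoint subspace. -/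
abbrev subStarAddMonoid (V : Submodule ℂ A) (hV : ∀ x ∈ V, star x ∈ V) : StarAddMonoid V where
  star x := ⟨star (x : A), hV x x.2⟩
  star_involutive x := Subtype.ext (star_star (x : A))
  star_add x y := Subtype.ext (star_add (x : A) y)

theorem subStarModule (V : Submodule ℂ A) (hV : ∀ x ∈ V, star x ∈ V) :
    letI := subStarAddMonoid V hV
    StarModule ℂ V :=
  letI := subStarAddMonoid V hV
  { star_smul := fun r x => Subtype.ext (star_smul r (x : A)) }

variable [OperatorSystem A]

theorem sub_map_compress (V : Submodule ℂ A) {k m : ℕ} (C : Matrix (Fin k) (Fin m) ℂ)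
    (X : Matrix (Fin k) (Fin k) V) :
    (compress C X).map V.subtype = compress C (X.map V.subtype) := by
  ext1 i j
  simp only [compress, Matrix.map_apply, Matrix.of_apply, map_sum, map_smul]

theorem sub_map_add_unit (V : Submodule ℂ A) {k : ℕ} (h1 : (unit : A) ∈ V) (r : ℝ)
    (X : Matrix (Fin k) (Fin k) V) :
    (X + (r : ℂ) • Matrix.diagonal (fun _ => (⟨unit, h1⟩ : V))).map V.subtype =
      X.map V.subtype + (r : ℂ) • Matrix.diagonal (fun _ => (unit : A)) := by
  ext1 i j
  by_cases h : i = j <;> simp [h]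

theorem sub_map_injective (V : Submodule ℂ A) {k : ℕ} {X Y : Matrix (Fin k) (Fin k) V}
    (h : X.map V.subtype = Y.map V.subtype) : X = Y := by
  ext1 i j
  exact Subtype.ext (congrFun (congrFun h i) j)

/-- A self-adjoint subspace `V` of an operator system that contains the order unit, with the cones
`M_k(V) ∩ M_k(A)_+`. -/
abbrev subSystem (V : Submodule ℂ A) (hV : ∀ x ∈ V, star x ∈ V) (h1 : (unit : A) ∈ V) :
    letI := subStarAddMonoid V hV
    haveI := subStarModule V hV
    OperatorSystem V :=
  letI := subStarAddMonoid V hV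
  haveI := subStarModule V hV
  { cone := fun k => {X | X.map V.subtype ∈ cone (S := A) k}
    unit := ⟨unit, h1⟩
    conjTranspose_eq := fun {k X} h => by
      have h' : X.map V.subtype ∈ cone (S := A) k := h
      exact sub_map_injective V (OperatorSystem.conjTranspose_eq h')
    add_mem := fun {k X Y} h h' => by
      have hX : X.map V.subtype ∈ cone (S := A) k := h
      exact OperatorSystem.add_mem hX h'
    smul_mem := fun {k X t} ht h => by
      have hX : X.map V.subtype ∈ cone (S := A) k := h
      exact OperatorSystem.smul_mem ht hX
    compress_mem := fun {k m} C {X} h => by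
      have hX : X.map V.subtype ∈ cone (S := A) k := h
      change (compress C X).map V.subtype ∈ cone (S := A) m
      rw [sub_map_compress]
      exact OperatorSystem.compress_mem C hX
    eq_zero := fun {k X} h h' => by
      have hX : X.map V.subtype ∈ cone (S := A) k := h
      have h0 := OperatorSystem.eq_zero hX h'
      exact sub_map_injective V h0
    star_unit := Subtype.ext star_unit
    exists_add_mem := fun {k} X hX => by
      have hX' : (X.map V.subtype).conjTranspose = X.map V.subtype :=
        congrArg (fun Y : Matrix (Fin k) (Fin k) V => Y.map V.subtype) hX
      obtain ⟨r, hr, h⟩ := exists_add_mem (X.map V.subtype) hX'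
      rw [← sub_map_add_unit V h1] at h
      exact ⟨r, hr, h⟩
    archimedean := fun {k} X hX h => by
      have hX' : (X.map V.subtype).conjTranspose = X.map V.subtype :=
        congrArg (fun Y : Matrix (Fin k) (Fin k) V => Y.map V.subtype) hX
      refine OperatorSystem.archimedean (X.map V.subtype) hX' fun r hr => ?_
      rw [← sub_map_add_unit V h1]
      exact h r hr }

end Subsystem

/-! ### Unital C*-algebras as operator systems -/

section CStar

variable {A : Type*} [CStarAlgebra A]

section Order

variable [PartialOrder A] [StarOrderedRing A]

theorem cstar_nonneg_iff {a : A} : 0 ≤ a ↔ ∃ y : A, a = star y * y :=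
  CStarAlgebra.nonneg_iff_eq_star_mul_self

theorem nonneg_ofMatrix_iff {n : ℕ} {X : Matrix (Fin n) (Fin n) A} :
    0 ≤ CStarMatrix.ofMatrix X ↔ ∃ Y : Matrix (Fin n) (Fin n) A, X = Y.conjTranspose * Y := by
  exact cstar_nonneg_iff (A := CStarMatrix (Fin n) (Fin n) A)

theorem ofMatrix_diagonal_one (n : ℕ) (r : ℝ) :
    CStarMatrix.ofMatrix ((r : ℂ) • Matrix.diagonal (fun _ : Fin n => (1 : A))) =
      algebraMap ℝ (CStarMatrix (Fin n) (Fin n) A) r := by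
  rw [Algebra.algebraMap_eq_smul_one]
  ext i j
  change (r : ℂ) • Matrix.diagonal (fun _ : Fin n => (1 : A)) i j =
    r • (1 : CStarMatrix (Fin n) (Fin n) A) i j
  rw [CStarMatrix.one_apply, Matrix.diagonal_apply]
  exact Complex.coe_smul r _

theorem compress_nonneg {n m : ℕ} (C : Matrix (Fin n) (Fin m) ℂ) {X : Matrix (Fin n) (Fin n) A}
    (hX : ∃ Y : Matrix (Fin n) (Fin n) A, X = Y.conjTranspose * Y) :
    0 ≤ CStarMatrix.ofMatrix (compress C X) := by
  obtain ⟨Y, rfl⟩ := hX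
  rcases m with _ | m
  · exact le_of_eq (by ext i; exact i.elim0)
  let Z : Fin n → Fin (m + 1) → A := fun t j => ∑ l, C l j • Y t l
  let W : Fin n → Matrix (Fin (m + 1)) (Fin (m + 1)) A :=
    fun t => Matrix.of fun i j => if i = 0 then Z t j else 0
  have key : compress C (Y.conjTranspose * Y) = ∑ t, (W t).conjTranspose * W t := by
    ext i j
    have hW : ∀ t, ((W t).conjTranspose * W t) i j = star (Z t i) * Z t j := by
      intro t
      rw [Matrix.mul_apply, Finset.sum_eq_single 0]
      · simp [W]
      · intro b _ hb
        simp [W, hb]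
      · simp
    rw [Matrix.sum_apply]
    simp only [hW, Z, star_sum, star_smul, Finset.sum_mul_sum, smul_mul_smul_comm]
    simp only [compress, Matrix.of_apply, Matrix.mul_apply, Matrix.conjTranspose_apply,
      Finset.smul_sum]
    rw [Finset.sum_comm' (s := Finset.univ) (t := fun _ => Finset.univ) (t' := Finset.univ)
      (s' := fun _ => Finset.univ) (by simp)]
    rw [Finset.sum_comm]
    conv_rhs => rw [Finset.sum_comm]
    refine Finset.sum_congr rfl fun k _ => ?_
    rw [Finset.sum_comm]
  have hsum : CStarMatrix.ofMatrix (∑ t, (W t).conjTranspose * W t) =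
      ∑ t, CStarMatrix.ofMatrix ((W t).conjTranspose * W t) :=
    map_sum (CStarMatrix.ofMatrixₗ (R := ℂ)) _ _
  rw [key, hsum]
  exact Finset.sum_nonneg fun t _ => nonneg_ofMatrix_iff.mpr ⟨W t, rfl⟩

theorem cstar_exists_add {n : ℕ} (X : Matrix (Fin n) (Fin n) A) (hX : X.conjTranspose = X) :
    ∃ r : ℝ, 0 < r ∧ 0 ≤ CStarMatrix.ofMatrix
      (X + (r : ℂ) • Matrix.diagonal (fun _ : Fin n => (1 : A))) := by
  refine ⟨‖CStarMatrix.ofMatrix X‖ + 1, by positivity, ?_⟩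
  have hs : IsSelfAdjoint (CStarMatrix.ofMatrix X) := hX
  rw [← CStarMatrix.of_add_of, ofMatrix_diagonal_one, map_add, map_one, ← add_assoc]
  refine add_nonneg ?_ zero_le_one
  have := hs.neg_algebraMap_norm_le_self
  rwa [← sub_nonneg, sub_neg_eq_add] at this

theorem cstar_archimedean {n : ℕ} (X : Matrix (Fin n) (Fin n) A)
    (h : ∀ r : ℝ, 0 < r → 0 ≤ CStarMatrix.ofMatrix
      (X + (r : ℂ) • Matrix.diagonal (fun _ : Fin n => (1 : A)))) :
    0 ≤ CStarMatrix.ofMatrix X := by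
  have hcl := CStarAlgebra.isClosed_nonneg (A := CStarMatrix (Fin n) (Fin n) A)
  have ht : Filter.Tendsto
      (fun r : ℝ => CStarMatrix.ofMatrix X + algebraMap ℝ (CStarMatrix (Fin n) (Fin n) A) r)
      (nhdsWithin 0 (Set.Ioi 0)) (nhds (CStarMatrix.ofMatrix X + algebraMap ℝ _ 0)) :=
    ((continuous_const.add (continuous_algebraMap ℝ _)).tendsto 0).mono_left
      nhdsWithin_le_nhds
  rw [map_zero, add_zero] at ht
  refine hcl.mem_of_tendsto ht ?_
  filter_upwards [self_mem_nhdsWithin] with r hr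
  have := h r hr
  rwa [← CStarMatrix.of_add_of, ofMatrix_diagonal_one] at this

theorem cstar_smul_nonneg {n : ℕ} {X : Matrix (Fin n) (Fin n) A} {t : ℝ} (ht : 0 ≤ t)
    (h : 0 ≤ CStarMatrix.ofMatrix X) : 0 ≤ CStarMatrix.ofMatrix ((t : ℂ) • X) := by
  have : 0 ≤ t • CStarMatrix.ofMatrix X := smul_nonneg ht h
  convert this using 1
  ext i j
  simp

end Order

/-- A unital C*-algebra `A` as an operator system: `M_n(A)_+` is the set of positive elements
`Y^* Y` of the C*-algebra `M_n(A)`. -/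
instance cstarSystem : OperatorSystem A where
  cone n := {X | ∃ Y : Matrix (Fin n) (Fin n) A, X = Y.conjTranspose * Y}
  unit := 1
  conjTranspose_eq {n X} h := by
    obtain ⟨Y, rfl⟩ := h
    simp
  add_mem h h' := by
    let _ := CStarAlgebra.spectralOrder A
    have := CStarAlgebra.spectralOrderedRing A
    rw [Set.mem_ofPred_eq, ← nonneg_ofMatrix_iff] at *
    exact add_nonneg h h'
  smul_mem ht h := by
    let _ := CStarAlgebra.spectralOrder A
    have := CStarAlgebra.spectralOrderedRing A
    rw [Set.mem_ofPred_eq, ← nonneg_ofMatrix_iff] at *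
    exact cstar_smul_nonneg ht h
  compress_mem C X h := by
    let _ := CStarAlgebra.spectralOrder A
    have := CStarAlgebra.spectralOrderedRing A
    exact nonneg_ofMatrix_iff.mp (compress_nonneg C h)
  eq_zero {n X} h h' := by
    let _ := CStarAlgebra.spectralOrder A
    have := CStarAlgebra.spectralOrderedRing A
    have h'' : 0 ≤ -CStarMatrix.ofMatrix X := nonneg_ofMatrix_iff.mpr h'
    have h0 : CStarMatrix.ofMatrix X = 0 :=
      le_antisymm (neg_nonneg.mp h'') (nonneg_ofMatrix_iff.mpr h)
    exact h0
  star_unit := star_one A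
  exists_add_mem X hX := by
    let _ := CStarAlgebra.spectralOrder A
    have := CStarAlgebra.spectralOrderedRing A
    obtain ⟨r, hr, h⟩ := cstar_exists_add X hX
    exact ⟨r, hr, nonneg_ofMatrix_iff.mp h⟩
  archimedean X _ h := by
    let _ := CStarAlgebra.spectralOrder A
    have := CStarAlgebra.spectralOrderedRing A
    exact nonneg_ofMatrix_iff.mp
      (cstar_archimedean X fun r hr => nonneg_ofMatrix_iff.mpr (h r hr))

end CStar

/-! ### The universal C*-algebra of an `n × n` unitary, and the operator system `V_n` -/

section Unc

/-- A unitary `n × n` matrix over some nonzero unital C*-algebra. -/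
structure UnitaryMatrix (n : ℕ) : Type (w + 1) where
  /-- the C*-algebra -/
  B : Type w
  [cstar : CStarAlgebra B]
  [nontrivial : Nontrivial B]
  /-- the unitary matrix -/
  W : Matrix (Fin n) (Fin n) B
  mem : W ∈ unitary (Matrix (Fin n) (Fin n) B)

attribute [instance] UnitaryMatrix.cstar UnitaryMatrix.nontrivial

instance (n : ℕ) : CStarAlgebra (lp (fun W : UnitaryMatrix.{w} n => W.B) ∞) where

theorem norm_entry_le_one {B : Type w} [CStarAlgebra B] {n : ℕ} {W : Matrix (Fin n) (Fin n) B}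
    (hW : W ∈ unitary (Matrix (Fin n) (Fin n) B)) (i j : Fin n) : ‖W i j‖ ≤ 1 := by
  let _ := CStarAlgebra.spectralOrder B
  have := CStarAlgebra.spectralOrderedRing B
  have hW' : CStarMatrix.ofMatrix W ∈ unitary (CStarMatrix (Fin n) (Fin n) B) := hW
  have h1 : ‖CStarMatrix.ofMatrix W‖ ≤ 1 := by
    have h2 := CStarRing.norm_star_mul_self (x := CStarMatrix.ofMatrix W)
    rw [(Unitary.mem_iff.mp hW').1] at h2
    nontriviality CStarMatrix (Fin n) (Fin n) B
    exact (CStarRing.norm_of_mem_unitary hW').le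
  exact (CStarMatrix.norm_entry_le_norm (M := CStarMatrix.ofMatrix W) (i := i) (j := j)).trans h1

/-- The tuple of the `(i,j)` entries of all unitary `n × n` matrices over C*-algebras. -/
def universalEntry (n : ℕ) (i j : Fin n) : lp (fun W : UnitaryMatrix.{w} n => W.B) ∞ :=
  ⟨fun W => W.W i j, memℓp_infty ⟨1, by
    rintro _ ⟨W, rfl⟩
    exact norm_entry_le_one W.mem i j⟩⟩

/-- The C*-subalgebra underlying `Unc n`. -/
def uncSubalgebra (n : ℕ) :
    StarSubalgebra ℂ (lp (fun W : UnitaryMatrix.{w} n => W.B) ∞) :=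
  (StarAlgebra.adjoin ℂ
    (Set.range fun ij : Fin n × Fin n => universalEntry.{w} n ij.1 ij.2)).topologicalClosure

instance (n : ℕ) : IsClosed (uncSubalgebra.{w} n : Set
    (lp (fun W : UnitaryMatrix.{w} n => W.B) ∞)) :=
  StarSubalgebra.isClosed_topologicalClosure _

/-- The universal unital C*-algebra `U_nc(n)` with generators `u_{ij}`, `1 ≤ i, j ≤ n`, subject to
the relation that `(u_{ij})` is unitary. It is realised as the C*-algebra generated by the entries
of the direct sum of all unitary `n × n` matrices over C*-algebras; the universal property is
`Unc.existsUnique_starAlgHom`. -/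
def Unc (n : ℕ) : Type (w + 1) := uncSubalgebra.{w} n

instance (n : ℕ) : CStarAlgebra (Unc.{w} n) :=
  inferInstanceAs (CStarAlgebra (uncSubalgebra.{w} n))

/-- The generators `u_{ij}` of `U_nc(n)`. -/
def Unc.u (n : ℕ) : Matrix (Fin n) (Fin n) (Unc.{w} n) := Matrix.of fun i j =>
  ⟨universalEntry n i j, StarSubalgebra.le_topologicalClosure _
    (StarAlgebra.subset_adjoin ℂ _ ⟨(i, j), rfl⟩)⟩

/-- Evaluation of an element of `U_nc(n)` at a unitary matrix. -/
def Unc.eval {n : ℕ} (x : UnitaryMatrix.{w} n) : Unc.{w} n →⋆ₐ[ℂ] x.B where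
  toFun a := a.1.1 x
  map_one' := rfl
  map_mul' _ _ := rfl
  map_zero' := rfl
  map_add' _ _ := rfl
  commutes' _ := rfl
  map_star' _ := rfl

theorem Unc.eval_u {n : ℕ} (x : UnitaryMatrix.{w} n) (i j : Fin n) :
    Unc.eval x (Unc.u n i j) = x.W i j := rfl

theorem Unc.ext_eval {n : ℕ} {a b : Unc.{w} n} (h : ∀ x, Unc.eval x a = Unc.eval x b) : a = b :=
  Subtype.ext (lp.ext (funext h))

theorem Unc.u_mem_unitary (n : ℕ) : Unc.u.{w} n ∈ unitary (Matrix (Fin n) (Fin n) (Unc n)) := by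
  rw [Unitary.mem_iff]
  constructor
  · ext1 i j
    refine Unc.ext_eval fun x => ?_
    have h := congrFun (congrFun (Unitary.mem_iff.mp x.mem).1 i) j
    simpa [Matrix.mul_apply, Matrix.star_apply, Unc.eval_u, Matrix.one_apply, apply_ite, map_star]
      using h
  · ext1 i j
    refine Unc.ext_eval fun x => ?_
    have h := congrFun (congrFun (Unitary.mem_iff.mp x.mem).2 i) j
    simpa [Matrix.mul_apply, Matrix.star_apply, Unc.eval_u, Matrix.one_apply, apply_ite, map_star]
      using h

open scoped CStarAlgebra in
theorem starAlgHom_continuous {A B : Type*} [CStarAlgebra A] [CStarAlgebra B] (π : A →⋆ₐ[ℂ] B) :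
    Continuous π := map_continuous π

/-- The universal property of `U_nc(n)`. -/
theorem Unc.existsUnique_starAlgHom (n : ℕ) {B : Type w} [CStarAlgebra B]
    (W : Matrix (Fin n) (Fin n) B) (hW : W ∈ unitary (Matrix (Fin n) (Fin n) B)) :
    ∃! π : Unc.{w} n →⋆ₐ[ℂ] B, ∀ i j, π (Unc.u n i j) = W i j := by
  have huniq : ∀ π ρ : Unc.{w} n →⋆ₐ[ℂ] B, (∀ i j, π (Unc.u n i j) = W i j) →
      (∀ i j, ρ (Unc.u n i j) = W i j) → π = ρ := by
    intro π ρ hπ hρ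
    have hπc : Continuous π := starAlgHom_continuous π
    have hρc : Continuous ρ := starAlgHom_continuous ρ
    refine StarAlgHom.ext_topologicalClosure hπc hρc ?_
    refine StarAlgHom.ext_adjoin ?_
    rintro ⟨x, hx⟩ ⟨⟨i, j⟩, rfl⟩
    exact (hπ i j).trans (hρ i j).symm
  rcases subsingleton_or_nontrivial B with hB | hB
  · let π : Unc.{w} n →⋆ₐ[ℂ] B :=
      { toFun := fun _ => 0
        map_one' := Subsingleton.elim _ _
        map_mul' := fun _ _ => Subsingleton.elim _ _
        map_zero' := Subsingleton.elim _ _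
        map_add' := fun _ _ => Subsingleton.elim _ _
        commutes' := fun _ => Subsingleton.elim _ _
        map_star' := fun _ => Subsingleton.elim _ _ }
    exact ⟨π, fun _ _ => Subsingleton.elim _ _, fun ρ hρ =>
      huniq _ _ hρ fun _ _ => Subsingleton.elim _ _⟩
  · let x : UnitaryMatrix.{w} n := ⟨B, W, hW⟩
    exact ⟨Unc.eval x, fun _ _ => rfl, fun ρ hρ => huniq _ _ hρ fun _ _ => rfl⟩

/-- The span of `1`, the `u_{ij}` and the `u_{ij}^*` in `U_nc(n)`. -/
def vnSubspace (n : ℕ) : Submodule ℂ (Unc.{w} n) :=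
  Submodule.span ℂ ({1} ∪ (Set.range fun ij : Fin n × Fin n => Unc.u n ij.1 ij.2) ∪
    Set.range fun ij : Fin n × Fin n => star (Unc.u n ij.1 ij.2))

theorem star_mem_vnSubspace {n : ℕ} (x : Unc.{w} n) (hx : x ∈ vnSubspace n) :
    star x ∈ vnSubspace n := by
  induction hx using Submodule.span_induction with
  | mem x hx =>
    rcases hx with (rfl | ⟨ij, rfl⟩) | ⟨ij, rfl⟩
    · rw [star_one]
      exact Submodule.subset_span (Or.inl (Or.inl rfl))
    · exact Submodule.subset_span (Or.inr ⟨ij, rfl⟩)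
    · rw [star_star]
      exact Submodule.subset_span (Or.inl (Or.inr ⟨ij, rfl⟩))
  | zero => rw [star_zero]; exact Submodule.zero_mem _
  | add x y _ _ hx hy => rw [star_add]; exact Submodule.add_mem _ hx hy
  | smul a x _ hx => rw [star_smul]; exact Submodule.smul_mem _ _ hx

/-- The operator system `V_n = span {1, u_{ij}, u_{ij}^*} ⊆ U_nc(n)`. -/
abbrev Vn (n : ℕ) : Type (w + 1) := vnSubspace.{w} n

theorem one_mem_vnSubspace (n : ℕ) : (1 : Unc.{w} n) ∈ vnSubspace n :=
  Submodule.subset_span (Or.inl (Or.inl rfl))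

instance (n : ℕ) : StarAddMonoid (Vn.{w} n) := subStarAddMonoid (vnSubspace n) star_mem_vnSubspace

instance (n : ℕ) : StarModule ℂ (Vn.{w} n) := subStarModule (vnSubspace n) star_mem_vnSubspace

/-- `V_n` as an operator subsystem of `U_nc(n)`. -/
instance vnSystem (n : ℕ) : OperatorSystem (Vn.{w} n) :=
  subSystem (vnSubspace n) star_mem_vnSubspace (one_mem_vnSubspace n)

end Unc

/-! ### The minimal and maximal tensor products -/

section Tensor

variable {S : Type u} [AddCommGroup S] [Module ℂ S] [StarAddMonoid S] [StarModule ℂ S]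
  [OperatorSystem S]
variable {T : Type v} [AddCommGroup T] [Module ℂ T] [StarAddMonoid T] [StarModule ℂ T]
  [OperatorSystem T]

/-- `φ` is a matricial state of `S`: a unital completely positive map `S → M_k`. -/
def IsMatrixState {k : ℕ} (φ : S →ₗ[ℂ] Matrix (Fin k) (Fin k) ℂ) : Prop :=
  φ unit = 1 ∧ ∀ (n : ℕ) (X : Matrix (Fin n) (Fin n) S), X ∈ cone n →
    (Matrix.comp (Fin n) (Fin n) (Fin k) (Fin k) ℂ (X.map φ)).PosSemidef

/-- The linear map `φ ⊗ ψ : S ⊗ T → M_k ⊗ M_l = M_{kl}`. -/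
def tensorMap {k l : ℕ} (φ : S →ₗ[ℂ] Matrix (Fin k) (Fin k) ℂ)
    (ψ : T →ₗ[ℂ] Matrix (Fin l) (Fin l) ℂ) :
    S ⊗[ℂ] T →ₗ[ℂ] Matrix (Fin k × Fin l) (Fin k × Fin l) ℂ :=
  TensorProduct.lift ((Matrix.kroneckerBilinear (R := ℂ)).compl₁₂ φ ψ)

variable (S T)

/-- The positive cone of `M_n(S ⊗_min T)`. -/
def minCone (n : ℕ) : Set (Matrix (Fin n) (Fin n) (S ⊗[ℂ] T)) :=
  {X | X.conjTranspose = X ∧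
    ∀ (k l : ℕ) (φ : S →ₗ[ℂ] Matrix (Fin k) (Fin k) ℂ) (ψ : T →ₗ[ℂ] Matrix (Fin l) (Fin l) ℂ),
      IsMatrixState φ → IsMatrixState ψ →
        (Matrix.comp (Fin n) (Fin n) _ _ ℂ (X.map (tensorMap φ ψ))).PosSemidef}

/-- The set `D_n^max(S, T)` of the matrices `A (P ⊗ Q) A^*` with `P ∈ M_k(S)_+`, `Q ∈ M_m(T)_+` and
`A` a scalar matrix. -/
def maxPreCone (n : ℕ) : Set (Matrix (Fin n) (Fin n) (S ⊗[ℂ] T)) :=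
  {X | ∃ (k m : ℕ) (P : Matrix (Fin k) (Fin k) S) (Q : Matrix (Fin m) (Fin m) T)
    (A : Matrix (Fin n) (Fin k × Fin m) ℂ), P ∈ cone k ∧ Q ∈ cone m ∧
      X = compress A.conjTranspose (Matrix.kroneckerMap (fun s t => s ⊗ₜ[ℂ] t) P Q)}

/-- The positive cone of `M_n(S ⊗_max T)`, the Archimedeanization of `D_n^max(S, T)`. -/
def maxCone (n : ℕ) : Set (Matrix (Fin n) (Fin n) (S ⊗[ℂ] T)) :=
  {X | X.conjTranspose = X ∧ ∀ ε : ℝ, 0 < ε →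
    X + (ε : ℂ) • Matrix.diagonal (fun _ => (unit : S) ⊗ₜ[ℂ] (unit : T)) ∈ maxPreCone S T n}

/-- `S ⊗_min T = S ⊗_max T`: both are the `*`-vector space `S ⊗ T` with order unit `1 ⊗ 1`, so this
says that their matricial cones agree. -/
def MinEqMax : Prop := ∀ n : ℕ, minCone S T n = maxCone S T n

/-- `S` is `(min,max)`-nuclear: `S ⊗_min T = S ⊗_max T` for all operator systems `T`. -/
def IsMinMaxNuclear : Prop :=
  ∀ (T : Type v) [AddCommGroup T] [Module ℂ T] [StarAddMonoid T] [StarModule ℂ T]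
    [OperatorSystem T], MinEqMax S T

end Tensor

/-! ### Property V -/

section PropertyV

variable {S : Type u} [AddCommGroup S] [Module ℂ S] [StarAddMonoid S] [StarModule ℂ S]
  [OperatorSystem S]

/-- The element
`1 ⊗ S₁₁ + ∑_{i,j} (1/2n) u_{ij} ⊗ P_{ij} + ∑_{i,j} (1/2n) u_{ji}^* ⊗ N_{ij}` of
`U_nc(n) ⊗ M_p(S)`. -/
def vElement {n p : ℕ} (S₁₁ : Matrix (Fin p) (Fin p) S)
    (P N : Fin n → Fin n → Matrix (Fin p) (Fin p) S) :
    Unc.{w} n ⊗[ℂ] Matrix (Fin p) (Fin p) S :=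
  1 ⊗ₜ S₁₁ + ∑ i, ∑ j, ((1 / (2 * n) : ℂ) • Unc.u n i j) ⊗ₜ P i j +
    ∑ i, ∑ j, ((1 / (2 * n) : ℂ) • star (Unc.u n j i)) ⊗ₜ N i j

variable (S)

/-- Property `𝔙_n` of the operator system `S`. The index set `{1, …, 2n}` is written as
`Fin n ⊕ Fin n`; thus `Λ_n^+` consists of the pairs `(inl i, inr j)` and `Λ_n^-` of the pairs
`(inr i, inl j)`, and the family `(S_{ij})_{(i,j) ∈ Λ_n}` is given by its restrictions `P` to
`Λ_n^+` and `N` to `Λ_n^-`. -/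
def HasPropertyVn (n : ℕ) : Prop :=
  ∀ (p : ℕ) (S₁₁ : Matrix (Fin p) (Fin p) S) (P N : Fin n → Fin n → Matrix (Fin p) (Fin p) S),
    (Matrix.of fun _ _ => vElement S₁₁ P N) ∈
        minCone (Unc.{w} n) (Matrix (Fin p) (Fin p) S) 1 →
      ∀ ε : ℝ, 0 < ε →
        ∃ R : Matrix (Fin n ⊕ Fin n) (Fin n ⊕ Fin n) (Matrix (Fin p) (Fin p) S),
          IsPos R ∧
          (∀ i j, R (Sum.inl i) (Sum.inr j) = P i j) ∧
          (∀ i j, R (Sum.inr i) (Sum.inl j) = N i j) ∧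
          ∑ i, R i i = (2 * n : ℂ) • (S₁₁ + (ε : ℂ) • unit)

/-- Property `𝔙`: property `𝔙_n` for every `n`. -/
def HasPropertyV : Prop := ∀ n : ℕ, 1 ≤ n → HasPropertyVn.{u, w} S n

end PropertyV

end OpSys

end

/-!
Write `V_n` for the span of `1`, `u_{ij}`, `u_{ij}^*`. The map `M_{2n} → V_n` that sends the
diagonal matrix units to `1`, the off-diagonal ones inside the two diagonal `n × n` blocks to `0`,
and `E_{i,n+j}` to `u_{ij}`, `E_{n+i,j}` to `u_{ji}^*`, is completely positive, because the block
matrix `[[1, u], [u^*, 1]]` is positive (`Vn.isPos_block`). Conversely positive matrices over `V_n`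
lift to positive scalar matrices (`Vn.exists_posSemidef_lift`). Property `𝔙_n` says that the
positive elements of `M_p(V_n ⊗_min S)` lift to `M_{2n} ⊗ M_p(S)` after adding `ε 1`, and the
equivalence with `V_n ⊗_min S = V_n ⊗_max S` follows by applying the positive block matrix in one
direction and the lifting in the other.

* The lifting is proved by duality. The cone of liftable elements, `blockCone`, is closed, and a
  functional separating a point from it amounts to a positive block matrix `[[α, H], [H^*, α]]`.
  After a perturbation that makes `α` invertible, conjugation by an inverse square root of `α` turns
  `H` into a contraction. This has a unitary dilation (`exists_unitary_dilation`), so the functional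
  comes from a completely positive map on `U_nc(n)` (`exists_isCP_unc`), and such a map is
  nonnegative on positive matrices over `V_n` (`mem_blockCone`).
* The same dilation shows that matricial states of `V_n` extend to `U_nc(n)`
  (`Vn.exists_extension`), without recourse to Arveson's extension theorem. Thus `V_n ⊗_min S` sits
  in `U_nc(n) ⊗_min S`, and `M_p(V_n ⊗_min S)` in `U_nc(n) ⊗_min M_p(S)` (`mem_minCone_unc_iff`).
  The latter passes between maps on `M_p(S)` and maps on `S` that need not be unital; it uses that
  every completely positive map is a compression of a unital one (`IsCP.exists_matrixState`).
* Comparison of coefficients in `V_n ⊗ S` is possible because `1`, `u_{ij}`, `u_{ij}^*` are linearly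
  independent (`Unc.exists_coeff`).
* For the statement about nuclearity, the finite-dimensional system `V_n` is copied to the universe
  over which nuclearity quantifies (`IsMinMaxNuclear.minEqMax_Vn`).
-/

noncomputable section

namespace OpSys

open OperatorSystem

/-! ### Completely positive maps into matrix algebras -/

section CompletelyPositive

variable {S : Type*} [AddCommGroup S] [Module ℂ S] [StarAddMonoid S] [StarModule ℂ S]
  [OperatorSystem S]
variable {ι κ : Type*} [Fintype ι] [Fintype κ]

/-- `φ : S → M_ι` is completely positive; it is not required to be unital. -/
def IsCP (φ : S →ₗ[ℂ] Matrix ι ι ℂ) : Prop :=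
  ∀ (n : ℕ) (X : Matrix (Fin n) (Fin n) S), X ∈ cone n →
    (Matrix.comp (Fin n) (Fin n) ι ι ℂ (X.map φ)).PosSemidef

theorem IsMatrixState.isCP {k : ℕ} {φ : S →ₗ[ℂ] Matrix (Fin k) (Fin k) ℂ}
    (hφ : IsMatrixState φ) : IsCP φ := hφ.2

theorem IsCP.posSemidef_comp {φ : S →ₗ[ℂ] Matrix ι ι ℂ} (hφ : IsCP φ) {X : Matrix κ κ S}
    (hX : IsPos X) : (Matrix.comp κ κ ι ι ℂ (X.map φ)).PosSemidef := by
  obtain ⟨k, e, h⟩ := hX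
  have := (hφ k _ h).submatrix (Prod.map e id)
  convert this using 1
  ext ⟨a, i⟩ ⟨b, j⟩
  simp

theorem IsCP.posSemidef {φ : S →ₗ[ℂ] Matrix ι ι ℂ} (hφ : IsCP φ) {s : S}
    (hs : IsPos (Matrix.of fun _ _ : Unit => s)) : (φ s).PosSemidef := by
  exact (hφ.posSemidef_comp hs).submatrix (fun i => ((), i))

theorem comp_map_conj [DecidableEq κ] {ι' : Type*} [Fintype ι'] (M : Matrix κ κ (Matrix ι ι ℂ))
    (C : Matrix ι ι' ℂ) :
    Matrix.comp κ κ ι' ι' ℂ (M.map fun a => C.conjTranspose * a * C) =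
      ((1 : Matrix κ κ ℂ) ⊗ₖ C).conjTranspose * Matrix.comp κ κ ι ι ℂ M *
        ((1 : Matrix κ κ ℂ) ⊗ₖ C) := by
  ext ⟨a, i⟩ ⟨b, j⟩
  simp [Matrix.mul_apply, Fintype.sum_prod_type, Matrix.one_apply, apply_ite]

/-- The linear map `s ↦ C^* φ(s) C`. -/
def conjMap (φ : S →ₗ[ℂ] Matrix ι ι ℂ) (C : Matrix ι κ ℂ) : S →ₗ[ℂ] Matrix κ κ ℂ where
  toFun s := C.conjTranspose * φ s * C
  map_add' := by simp [Matrix.mul_add, Matrix.add_mul]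
  map_smul' := by simp

theorem conjMap_apply (φ : S →ₗ[ℂ] Matrix ι ι ℂ) (C : Matrix ι κ ℂ) (s : S) :
    conjMap φ C s = C.conjTranspose * φ s * C := rfl

theorem IsCP.conjMap {φ : S →ₗ[ℂ] Matrix ι ι ℂ} (hφ : IsCP φ) (C : Matrix ι κ ℂ) :
    IsCP (conjMap φ C) := by
  intro n X hX
  have := (hφ n X hX).conjTranspose_mul_mul_same ((1 : Matrix (Fin n) (Fin n) ℂ) ⊗ₖ C)
  rw [← comp_map_conj] at this
  exact this

theorem isPos_unit_real_smul_add {s : S} (hs : star s = s) :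
    ∃ r : ℝ, IsPos (Matrix.of fun _ _ : Unit => (r : ℂ) • (unit : S) + s) ∧
      IsPos (Matrix.of fun _ _ : Unit => (r : ℂ) • (unit : S) - s) := by
  have key : ∀ t : S, star t = t → ∃ r : ℝ, 0 < r ∧ ∀ r' ≥ r,
      IsPos (Matrix.of fun _ _ : Unit => (r' : ℂ) • (unit : S) + t) := by
    intro t ht
    obtain ⟨r, hr, h⟩ := exists_isPos_add (Matrix.of fun _ _ : Unit => t) (by ext; simpa using ht)
    obtain ⟨r₁, hr₁, h₁⟩ := exists_isPos_add (Matrix.of fun _ _ : Unit => (0 : S))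
      (by ext; simp)
    refine ⟨r, hr, fun r' hr' => ?_⟩
    have := h.add (h₁.smul (t := (r' - r) / r₁) (div_nonneg (sub_nonneg.2 hr') hr₁.le))
    convert this using 1
    ext i j
    have hr₁' : (r₁ : ℂ) ≠ 0 := by exact_mod_cast hr₁.ne'
    simp only [Matrix.of_apply, Matrix.add_apply, Matrix.smul_apply, Matrix.diagonal_apply_eq,
      smul_smul, zero_add]
    rw [add_assoc, ← add_smul, add_comm]
    congr 2
    push_cast
    field_simp
    ring
  obtain ⟨r, -, h⟩ := key s hs
  obtain ⟨r', -, h'⟩ := key (-s) (by rw [star_neg, hs])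
  refine ⟨max r r', h _ (le_max_left _ _), ?_⟩
  simpa [sub_eq_add_neg] using h' _ (le_max_right _ _)

theorem IsCP.isHermitian {φ : S →ₗ[ℂ] Matrix ι ι ℂ} (hφ : IsCP φ) {s : S} (hs : star s = s) :
    (φ s).IsHermitian := by
  obtain ⟨r, h, h'⟩ := isPos_unit_real_smul_add hs
  have h2 := (hφ.posSemidef h).isHermitian.sub (hφ.posSemidef h').isHermitian
  have h3 : φ ((r : ℂ) • (unit : S) + s) - φ ((r : ℂ) • (unit : S) - s) = (2 : ℝ) • φ s := by
    simp only [map_add, map_sub, two_smul]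
    abel
  rw [h3] at h2
  have h4 : (2 : ℝ) • (φ s).conjTranspose = (2 : ℝ) • φ s := by
    have := h2.eq
    rwa [Matrix.conjTranspose_smul, star_trivial] at this
  exact smul_right_injective _ (two_ne_zero (α := ℝ)) h4

theorem IsCP.map_star {φ : S →ₗ[ℂ] Matrix ι ι ℂ} (hφ : IsCP φ) (s : S) :
    φ (star s) = (φ s).conjTranspose := by
  conv_rhs => rw [← realPart_add_I_smul_imaginaryPart s]
  conv_lhs => rw [← realPart_add_I_smul_imaginaryPart s]
  have h1 := (hφ.isHermitian (realPart s).2).eq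
  have h2 := (hφ.isHermitian (imaginaryPart s).2).eq
  rw [star_add, star_smul, (realPart s).2.star_eq, (imaginaryPart s).2.star_eq, map_add, map_add,
    map_smul, map_smul, Matrix.conjTranspose_add, Matrix.conjTranspose_smul, h1, h2]

/-- The support of `φ(s)` is contained in the support of `φ(1)`, because `-r 1 ≤ s ≤ r 1` for
self-adjoint `s` and some `r`. -/
theorem IsCP.mulVec_eq_zero {φ : S →ₗ[ℂ] Matrix ι ι ℂ} (hφ : IsCP φ) {x : ι → ℂ}
    (hx : (φ unit).mulVec x = 0) (s : S) : (φ s).mulVec x = 0 := by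
  have key : ∀ s : S, star s = s → (φ s).mulVec x = 0 := by
    intro s hs
    obtain ⟨r, h, h'⟩ := isPos_unit_real_smul_add hs
    have h1 := (hφ.posSemidef h).dotProduct_mulVec_nonneg x
    have h2 := (hφ.posSemidef h').dotProduct_mulVec_nonneg x
    have e1 : (φ ((r : ℂ) • (unit : S) + s)).mulVec x = (φ s).mulVec x := by
      rw [map_add, map_smul, Matrix.add_mulVec, Matrix.smul_mulVec, hx, smul_zero, zero_add]
    have e2 : (φ ((r : ℂ) • (unit : S) - s)).mulVec x = -(φ s).mulVec x := by
      rw [map_sub, map_smul, Matrix.sub_mulVec, Matrix.smul_mulVec, hx, smul_zero, zero_sub]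
    rw [e2, dotProduct_neg] at h2
    rw [← e1, ← (hφ.posSemidef h).dotProduct_mulVec_zero_iff, e1]
    rw [e1] at h1
    exact le_antisymm (neg_nonneg.1 h2) h1
  rw [← realPart_add_I_smul_imaginaryPart s, map_add, map_smul, Matrix.add_mulVec,
    Matrix.smul_mulVec, key _ (realPart s).2, key _ (imaginaryPart s).2, smul_zero, add_zero]

/-- A rank factorisation of a positive semidefinite matrix. -/
theorem exists_rank_factorization [DecidableEq ι] {a : Matrix ι ι ℂ} (ha : a.PosSemidef) :
    ∃ (r : ℕ) (C : Matrix (Fin r) ι ℂ) (D : Matrix ι (Fin r) ℂ),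
      a = C.conjTranspose * C ∧ C * D = 1 := by
  classical
  set d := ha.1.eigenvalues with hd
  set V : Matrix ι ι ℂ := (ha.1.eigenvectorUnitary : Matrix ι ι ℂ) with hV
  have hVV : V.conjTranspose * V = 1 := by
    have := (Unitary.mem_iff.1 ha.1.eigenvectorUnitary.2).1
    simpa [Matrix.star_eq_conjTranspose] using this
  have hspec : a = V * Matrix.diagonal (fun i => (d i : ℂ)) * V.conjTranspose := by
    have := ha.1.spectral_theorem
    rw [Unitary.conjStarAlgAut_apply] at this
    simpa [Matrix.star_eq_conjTranspose, Function.comp_def] using this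
  have hd0 : ∀ i, 0 ≤ d i := ha.eigenvalues_nonneg
  let e := Fintype.equivFin {i // d i ≠ 0}
  let C : Matrix {i // d i ≠ 0} ι ℂ := Matrix.of fun i x => (Real.sqrt (d i) : ℂ) * star (V x i)
  let D : Matrix ι {i // d i ≠ 0} ℂ := Matrix.of fun x i => V x i * (Real.sqrt (d i) : ℂ)⁻¹
  refine ⟨_, C.submatrix e.symm id, D.submatrix id e.symm, ?_, ?_⟩
  · ext x y
    rw [hspec]
    rw [Matrix.mul_apply, Matrix.mul_apply]
    simp only [Matrix.mul_diagonal, Matrix.conjTranspose_apply, Matrix.submatrix_apply, id, C,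
      Matrix.of_apply]
    rw [Equiv.sum_comp e.symm (fun i : {i // d i ≠ 0} =>
      star ((Real.sqrt (d i) : ℂ) * star (V x i)) * ((Real.sqrt (d i) : ℂ) * star (V y i)))]
    have hg : ∀ i, star ((Real.sqrt (d i) : ℂ) * star (V x i)) *
        ((Real.sqrt (d i) : ℂ) * star (V y i)) = V x i * d i * star (V y i) := by
      intro i
      have : (Real.sqrt (d i) : ℂ) * Real.sqrt (d i) = d i := by
        exact_mod_cast Real.mul_self_sqrt (hd0 i)
      rw [star_mul', star_star, ← this]
      simp only [Complex.star_def, Complex.conj_ofReal]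
      ring
    simp only [hg]
    symm
    refine (Finset.sum_subtype (Finset.univ.filter fun i => d i ≠ 0) (by simp)
      (fun i => V x i * d i * star (V y i))).symm.trans (Finset.sum_filter_of_ne ?_)
    rintro i - h hi
    simp [hi] at h
  · have : C * D = 1 := by
      ext i j
      have h := congrFun (congrFun hVV i) j
      have hi : (Real.sqrt (d i) : ℂ) ≠ 0 := by
        exact_mod_cast (Real.sqrt_pos.2 (lt_of_le_of_ne (hd0 i) (Ne.symm i.2))).ne'
      have hj : (Real.sqrt (d j) : ℂ) ≠ 0 := by
        exact_mod_cast (Real.sqrt_pos.2 (lt_of_le_of_ne (hd0 j) (Ne.symm j.2))).ne'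
      simp only [Matrix.mul_apply, Matrix.conjTranspose_apply] at h
      simp only [Matrix.mul_apply, C, D, Matrix.of_apply]
      calc _ = (Real.sqrt (d i) : ℂ) * (∑ x, star (V x i) * V x j) * (Real.sqrt (d j) : ℂ)⁻¹ := by
            rw [Finset.mul_sum, Finset.sum_mul]
            exact Finset.sum_congr rfl fun _ _ => by ring
        _ = _ := by
            rw [h]
            by_cases hij : i = j
            · subst hij
              simp [hi]
            · have : (i : ι) ≠ j := fun h => hij (Subtype.ext h)
              simp [hij, this]
    rw [← Matrix.submatrix_mul _ _ _ id _ Function.bijective_id, this]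
    exact Matrix.submatrix_one_equiv e.symm

/-- A completely positive map is a compression of a unital one. -/
theorem IsCP.exists_matrixState {φ : S →ₗ[ℂ] Matrix ι ι ℂ} (hφ : IsCP φ) :
    ∃ (r : ℕ) (ψ : S →ₗ[ℂ] Matrix (Fin r) (Fin r) ℂ) (C : Matrix (Fin r) ι ℂ),
      IsMatrixState ψ ∧ φ = OpSys.conjMap ψ C := by
  classical
  have hu : IsPos (Matrix.of fun _ _ : Unit => (unit : S)) := by
    obtain ⟨r, hr, h⟩ := exists_isPos_add (Matrix.of fun _ _ : Unit => (0 : S)) (by ext; simp)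
    have := h.smul (t := r⁻¹) (by positivity)
    convert this using 1
    ext i j
    have : (r : ℂ) ≠ 0 := by exact_mod_cast hr.ne'
    simp [-Complex.coe_smul, smul_smul, this]
  obtain ⟨r, C, D, hC, hCD⟩ := exists_rank_factorization (hφ.posSemidef hu)
  refine ⟨r, OpSys.conjMap φ D, C, ⟨?_, hφ.conjMap D⟩, ?_⟩
  · rw [conjMap_apply, hC, ← Matrix.mul_assoc, ← Matrix.conjTranspose_mul, hCD, Matrix.mul_assoc,
      hCD]
    simp
  · -- `D * C` is the projection onto the support of `φ 1` along its kernel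
    have h0 : ∀ s, φ s * (1 - D * C) = 0 := by
      intro s
      have h1 : φ unit * (1 - D * C) = 0 := by
        rw [hC, Matrix.mul_sub, Matrix.mul_one, Matrix.mul_assoc, ← Matrix.mul_assoc C, hCD,
          Matrix.one_mul, sub_self]
      ext i j
      have h2 : (φ unit).mulVec (fun k => (1 - D * C : Matrix ι ι ℂ) k j) = 0 := by
        ext i
        exact congrFun (congrFun h1 i) j
      exact congrFun (hφ.mulVec_eq_zero h2 s) i
    have h1 : ∀ s, φ s = φ s * (D * C) := fun s => by
      have := h0 s
      rwa [Matrix.mul_sub, Matrix.mul_one, sub_eq_zero] at this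
    have h2 : ∀ s, φ s = (D * C).conjTranspose * φ s := fun s => by
      have := congrArg Matrix.conjTranspose (h1 (star s))
      rwa [Matrix.conjTranspose_mul, hφ.map_star, Matrix.conjTranspose_conjTranspose] at this
    ext1 s
    rw [conjMap_apply, conjMap_apply]
    conv_lhs => rw [h1 s, h2 s]
    simp only [Matrix.conjTranspose_mul, Matrix.mul_assoc]

end CompletelyPositive

section CPTensor

variable {S : Type*} [AddCommGroup S] [Module ℂ S] [StarAddMonoid S] [StarModule ℂ S]
  [OperatorSystem S]
variable {T : Type*} [AddCommGroup T] [Module ℂ T] [StarAddMonoid T] [StarModule ℂ T]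
  [OperatorSystem T]
variable {ι κ : Type*} [Fintype ι] [Fintype κ]

/-- The linear map `φ ⊗ ψ : S ⊗ T → M_ι ⊗ M_κ`, for arbitrary finite index types. -/
def kronMap (φ : S →ₗ[ℂ] Matrix ι ι ℂ) (ψ : T →ₗ[ℂ] Matrix κ κ ℂ) :
    S ⊗[ℂ] T →ₗ[ℂ] Matrix (ι × κ) (ι × κ) ℂ :=
  TensorProduct.lift ((Matrix.kroneckerBilinear (R := ℂ)).compl₁₂ φ ψ)

theorem tensorMap_eq_kronMap {k l : ℕ} (φ : S →ₗ[ℂ] Matrix (Fin k) (Fin k) ℂ)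
    (ψ : T →ₗ[ℂ] Matrix (Fin l) (Fin l) ℂ) : tensorMap φ ψ = kronMap φ ψ := rfl

theorem kronMap_tmul (φ : S →ₗ[ℂ] Matrix ι ι ℂ) (ψ : T →ₗ[ℂ] Matrix κ κ ℂ) (s : S) (t : T) :
    kronMap φ ψ (s ⊗ₜ t) = φ s ⊗ₖ ψ t := rfl

theorem kronMap_conjMap {ι' κ' : Type*} [Fintype ι'] [Fintype κ'] (φ : S →ₗ[ℂ] Matrix ι ι ℂ)
    (ψ : T →ₗ[ℂ] Matrix κ κ ℂ) (C : Matrix ι ι' ℂ) (D : Matrix κ κ' ℂ) (x : S ⊗[ℂ] T) :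
    kronMap (conjMap φ C) (conjMap ψ D) x =
      (C ⊗ₖ D).conjTranspose * kronMap φ ψ x * (C ⊗ₖ D) := by
  induction x with
  | zero => simp
  | tmul s t =>
    rw [kronMap_tmul, kronMap_tmul, conjMap_apply, conjMap_apply, Matrix.mul_kronecker_mul,
      Matrix.mul_kronecker_mul, Matrix.conjTranspose_kronecker]
  | add x y hx hy => rw [map_add, map_add, hx, hy, Matrix.mul_add, Matrix.add_mul]

/-- Elements of the minimal cone are positive under all tensor products of completely positive
maps, unital or not. -/
theorem posSemidef_of_mem_minCone {n : ℕ} {X : Matrix (Fin n) (Fin n) (S ⊗[ℂ] T)}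
    (hX : X ∈ minCone S T n) {φ : S →ₗ[ℂ] Matrix ι ι ℂ} {ψ : T →ₗ[ℂ] Matrix κ κ ℂ} (hφ : IsCP φ)
    (hψ : IsCP ψ) : (Matrix.comp (Fin n) (Fin n) _ _ ℂ (X.map (kronMap φ ψ))).PosSemidef := by
  obtain ⟨k, φ, C, hφ', rfl⟩ := hφ.exists_matrixState
  obtain ⟨l, ψ, D, hψ', rfl⟩ := hψ.exists_matrixState
  have := (hX.2 k l φ ψ hφ' hψ').conjTranspose_mul_mul_same
    ((1 : Matrix (Fin n) (Fin n) ℂ) ⊗ₖ (C ⊗ₖ D))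
  rw [← comp_map_conj] at this
  convert this using 2
  ext a b : 2
  simp only [Matrix.map_apply, kronMap_conjMap, tensorMap_eq_kronMap]

end CPTensor

/-! ### Dilation of contractions and completely positive maps on `U_nc(n)` -/

section Dilation

open scoped MatrixOrder in
/-- If `T = [[0, Y], [Y^*, 0]]` satisfies `1 + T ≥ 0`, then `-1 ≤ T ≤ 1` and `T + i √(1 - T²)` is a
unitary matrix. Its upper right corner is `Y` since `1 - T²`, hence its square root, commutes with
`diag(1, -1)`. -/
theorem exists_unitary_dilation {N : Type*} [Fintype N] [DecidableEq N] (Y : Matrix N N ℂ)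
    (hY : (Matrix.fromBlocks 1 Y Y.conjTranspose 1).PosSemidef) :
    ∃ U : Matrix (N ⊕ N) (N ⊕ N) ℂ, U.conjTranspose * U = 1 ∧
      ∀ i j, U (Sum.inl i) (Sum.inr j) = Y i j := by
  set T : Matrix (N ⊕ N) (N ⊕ N) ℂ := Matrix.fromBlocks 0 Y Y.conjTranspose 0 with hT
  set J : Matrix (N ⊕ N) (N ⊕ N) ℂ :=
    Matrix.diagonal (Sum.elim (fun _ => 1) (fun _ => -1)) with hJ
  have hTJ : T * J = -(J * T) := by
    ext (i | i) (j | j) <;> simp [hT, hJ]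
  have hJJ : J * J = 1 := by
    rw [hJ, Matrix.diagonal_mul_diagonal, ← Matrix.diagonal_one]
    congr 1
    funext i
    rcases i with i | i <;> simp
  have hJs : J.conjTranspose = J := by
    rw [hJ, Matrix.diagonal_conjTranspose]
    congr 1
    funext i
    rcases i with i | i <;> simp
  have hTs : T.conjTranspose = T := by
    rw [hT, Matrix.fromBlocks_conjTranspose]
    simp
  have hp : (1 + T).PosSemidef := by
    convert hY using 1
    rw [hT, ← Matrix.fromBlocks_one, Matrix.fromBlocks_add]
    simp
  have hm : (1 - T).PosSemidef := by
    convert hp.conjTranspose_mul_mul_same J using 1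
    rw [hJs, Matrix.mul_add, Matrix.add_mul, Matrix.mul_one, hJJ, Matrix.mul_assoc, hTJ,
      Matrix.mul_neg, ← Matrix.mul_assoc, hJJ, Matrix.one_mul, sub_eq_add_neg]
  have hTT : (1 - T * T).PosSemidef := by
    have h1 := hp.conjTranspose_mul_mul_same (1 - T)
    have h2 := hm.conjTranspose_mul_mul_same (1 + T)
    rw [hm.isHermitian.eq] at h1
    rw [hp.isHermitian.eq] at h2
    have h3 := (h1.add h2).smul (a := (1 / 2 : ℝ)) (by norm_num)
    convert h3 using 1
    have : (1 - T) * (1 + T) * (1 - T) + (1 + T) * (1 - T) * (1 + T) =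
        (2 : ℝ) • (1 - T * T) := by
      rw [two_smul]
      noncomm_ring
    rw [this, smul_smul]
    norm_num
  set E := CFC.sqrt (1 - T * T) with hE
  have hEE : E * E = 1 - T * T :=
    CFC.sqrt_mul_sqrt_self _ (Matrix.nonneg_iff_posSemidef.2 hTT)
  have hEs : E.conjTranspose = E :=
    (Matrix.nonneg_iff_posSemidef.1 (CFC.sqrt_nonneg (1 - T * T))).isHermitian.eq
  have hET : Commute E T := by
    rw [hE, CFC.sqrt]
    refine Commute.cfcₙ_nnreal ?_ _
    exact ((Commute.one_left T).sub_left ((Commute.refl T).mul_left (Commute.refl T)))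
  have hEJ : Commute E J := by
    rw [hE, CFC.sqrt]
    refine Commute.cfcₙ_nnreal ?_ _
    refine (Commute.one_left J).sub_left ?_
    rw [commute_iff_eq, Matrix.mul_assoc, hTJ, Matrix.mul_neg, ← Matrix.mul_assoc, hTJ]
    simp [Matrix.mul_assoc]
  refine ⟨T + Complex.I • E, ?_, fun i j => ?_⟩
  · rw [Matrix.conjTranspose_add, Matrix.conjTranspose_smul, hTs, hEs, Matrix.add_mul,
      Matrix.mul_add, Matrix.mul_add]
    simp only [Complex.star_def, Complex.conj_I, Matrix.smul_mul, Matrix.mul_smul, smul_smul,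
      hET.eq, hEE]
    simp
  · have h := congrFun (congrFun hEJ.eq (Sum.inl i)) (Sum.inr j)
    simp only [hJ, Matrix.mul_diagonal, Matrix.diagonal_mul, Sum.elim_inl, Sum.elim_inr] at h
    have h0 : E (Sum.inl i) (Sum.inr j) = 0 := by linear_combination (-1 / 2 : ℂ) * h
    simp [hT, h0]

/-- A contraction `(Y_{ij})` with matrix entries gives rise to a matricial state of `U_nc(n)` that
sends `u_{ij}` to `Y_{ij}`: compress the representation belonging to a unitary dilation. -/
theorem exists_matrixState_unc {n k : ℕ} (Y : Fin n → Fin n → Matrix (Fin k) (Fin k) ℂ)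
    (hY : (Matrix.fromBlocks 1 (Matrix.comp _ _ _ _ ℂ (Matrix.of Y))
      (Matrix.comp _ _ _ _ ℂ (Matrix.of Y)).conjTranspose 1).PosSemidef) :
    ∃ θ : Unc.{w} n →ₗ[ℂ] Matrix (Fin k) (Fin k) ℂ, IsMatrixState θ ∧
      ∀ i j, θ (Unc.u n i j) = Y i j := by
  obtain ⟨U, hU, hUY⟩ := exists_unitary_dilation _ hY
  -- the index set of the dilation space, lifted to the universe of the C*-algebras
  let K := ULift.{w} (Fin k ⊕ Fin k)
  -- the columns are swapped so that `Y` appears in the upper left corner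
  let r : Fin n × K ≃ (Fin n × Fin k) ⊕ (Fin n × Fin k) :=
    ((Equiv.refl (Fin n)).prodCongr Equiv.ulift).trans (Equiv.prodSumDistrib _ _ _)
  let c : Fin n × K ≃ (Fin n × Fin k) ⊕ (Fin n × Fin k) :=
    ((Equiv.refl (Fin n)).prodCongr (Equiv.ulift.trans (Equiv.sumComm _ _))).trans
      (Equiv.prodSumDistrib _ _ _)
  let V : Matrix (Fin n × K) (Fin n × K) ℂ := U.submatrix r c
  have hV : V.conjTranspose * V = 1 := by
    rw [Matrix.conjTranspose_submatrix, Matrix.submatrix_mul_equiv, hU,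
      Matrix.submatrix_one_equiv]
  have hV' : V * V.conjTranspose = 1 := mul_eq_one_comm.1 hV
  let W : Matrix (Fin n) (Fin n) (CStarMatrix K K ℂ) :=
    Matrix.of fun i j => CStarMatrix.ofMatrix (Matrix.of fun s t => V (i, s) (j, t))
  have hW : W ∈ unitary (Matrix (Fin n) (Fin n) (CStarMatrix K K ℂ)) := by
    have sum_apply : ∀ (f : Fin n → CStarMatrix K K ℂ) (s t : K),
        (∑ i, f i) s t = ∑ i, f i s t := fun f s t =>
      Matrix.sum_apply s t Finset.univ f
    rw [Unitary.mem_iff]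
    constructor
    · ext i j s t
      have h := congrFun (congrFun hV (i, s)) (j, t)
      rw [Matrix.mul_apply, Fintype.sum_prod_type] at h
      rw [Matrix.mul_apply, sum_apply]
      refine h.trans ?_
      simp only [Matrix.one_apply, Prod.mk.injEq]
      by_cases hij : i = j <;> simp [hij, CStarMatrix.one_apply]
    · ext i j s t
      have h := congrFun (congrFun hV' (i, s)) (j, t)
      rw [Matrix.mul_apply, Fintype.sum_prod_type] at h
      rw [Matrix.mul_apply, sum_apply]
      refine h.trans ?_
      simp only [Matrix.one_apply, Prod.mk.injEq]
      by_cases hij : i = j <;> simp [hij, CStarMatrix.one_apply]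
  obtain ⟨π, hπ, -⟩ := Unc.existsUnique_starAlgHom n W hW
  let g : Fin k → K := fun a => ULift.up (Sum.inl a)
  let θ : Unc.{w} n →ₗ[ℂ] Matrix (Fin k) (Fin k) ℂ :=
    { toFun x := Matrix.of fun a b => π x (g a) (g b)
      map_add' x y := by
        ext a b
        simp
      map_smul' z x := by
        ext a b
        simp }
  refine ⟨θ, ⟨?_, ?_⟩, fun i j => ?_⟩
  · ext a b
    change π 1 (g a) (g b) = _
    have hg : Function.Injective g := fun a b h => Sum.inl.inj (ULift.up.inj h)
    rw [map_one, CStarMatrix.one_apply, Matrix.one_apply]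
    simp only [hg.eq_iff]
  · rintro m X ⟨Z, rfl⟩
    let G : Matrix (Fin m × K) (Fin m × Fin k) ℂ :=
      Matrix.of fun x y => π (Z x.1 y.1) x.2 (g y.2)
    have : Matrix.comp (Fin m) (Fin m) (Fin k) (Fin k) ℂ ((Z.conjTranspose * Z).map θ) =
        G.conjTranspose * G := by
      ext ⟨i, a⟩ ⟨j, b⟩
      rw [Matrix.mul_apply, Fintype.sum_prod_type]
      change π ((Z.conjTranspose * Z) i j) (g a) (g b) = _
      rw [Matrix.mul_apply, map_sum]
      refine (Matrix.sum_apply _ _ Finset.univ _).trans (Finset.sum_congr rfl fun l _ => ?_)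
      rw [map_mul, Matrix.conjTranspose_apply, map_star]
      exact CStarMatrix.mul_apply
    rw [this]
    exact Matrix.posSemidef_conjTranspose_mul_self G
  · ext a b
    change π (Unc.u n i j) (g a) (g b) = _
    rw [hπ]
    exact hUY (i, a) (j, b)

end Dilation

/-! ### Lifting positive matrices over `V_n` to positive scalar matrices -/

section Lifting

open scoped MatrixOrder in
theorem posSemidef_iff_exists_eq_conjTranspose_mul {N : Type*} [Fintype N] {A : Matrix N N ℂ} :
    A.PosSemidef ↔ ∃ B : Matrix N N ℂ, A = B.conjTranspose * B := by
  classical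
  rw [← Matrix.nonneg_iff_posSemidef, CStarAlgebra.nonneg_iff_eq_star_mul_self]
  rfl

/-- A positive block matrix `[[α, H], [H^*, α]]` with invertible `α` defines a completely positive
map by `1 ↦ α` and `u_{ij} ↦ H_{ij}`: conjugating with `C⁻¹`, where `α = C^* C`, reduces to the
unital case. -/
theorem exists_isCP_unc {n k : ℕ} {α : Matrix (Fin k) (Fin k) ℂ} (hα : α.PosDef)
    (H : Fin n → Fin n → Matrix (Fin k) (Fin k) ℂ)
    (h : (Matrix.fromBlocks ((1 : Matrix (Fin n) (Fin n) ℂ) ⊗ₖ α)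
      (Matrix.comp _ _ _ _ ℂ (Matrix.of H)) (Matrix.comp _ _ _ _ ℂ (Matrix.of H)).conjTranspose
      ((1 : Matrix (Fin n) (Fin n) ℂ) ⊗ₖ α)).PosSemidef) :
    ∃ θ : Unc.{w} n →ₗ[ℂ] Matrix (Fin k) (Fin k) ℂ, IsCP θ ∧ θ 1 = α ∧
      ∀ i j, θ (Unc.u n i j) = H i j := by
  obtain ⟨C, hC⟩ := posSemidef_iff_exists_eq_conjTranspose_mul.1 hα.posSemidef
  have hCu : IsUnit C.det := by
    have h1 := (Matrix.isUnit_iff_isUnit_det _).1 (hα.posSemidef.posDef_iff_isUnit.1 hα)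
    rw [hC, Matrix.det_mul] at h1
    exact isUnit_of_mul_isUnit_right h1
  have h1 : C * C⁻¹ = 1 := Matrix.mul_nonsing_inv C hCu
  have h2 : C⁻¹ * C = 1 := Matrix.nonsing_inv_mul C hCu
  have h1' : C⁻¹.conjTranspose * C.conjTranspose = 1 := by
    rw [← Matrix.conjTranspose_mul, h1, Matrix.conjTranspose_one]
  have h2' : C.conjTranspose * C⁻¹.conjTranspose = 1 := by
    rw [← Matrix.conjTranspose_mul, h2, Matrix.conjTranspose_one]
  obtain ⟨θ, hθ, hθY⟩ := exists_matrixState_unc.{w} (n := n)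
    (fun i j => C⁻¹.conjTranspose * H i j * C⁻¹) (by
      set D : Matrix (Fin n × Fin k) (Fin n × Fin k) ℂ := (1 : Matrix (Fin n) (Fin n) ℂ) ⊗ₖ C⁻¹
        with hD
      convert h.conjTranspose_mul_mul_same (Matrix.fromBlocks D 0 0 D) using 1
      have e1 : Matrix.comp _ _ _ _ ℂ (Matrix.of fun i j => C⁻¹.conjTranspose * H i j * C⁻¹) =
          D.conjTranspose * Matrix.comp _ _ _ _ ℂ (Matrix.of H) * D :=
        comp_map_conj (Matrix.of H) C⁻¹
      have e2 : D.conjTranspose * ((1 : Matrix (Fin n) (Fin n) ℂ) ⊗ₖ α) * D = 1 := by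
        rw [hD, Matrix.conjTranspose_kronecker, ← Matrix.mul_kronecker_mul,
          ← Matrix.mul_kronecker_mul, hC, ← Matrix.mul_assoc, h1', Matrix.one_mul, h1]
        simp
      rw [e1, Matrix.fromBlocks_conjTranspose, Matrix.fromBlocks_multiply,
        Matrix.fromBlocks_multiply]
      simp [e2, Matrix.mul_assoc])
  refine ⟨conjMap θ C, hθ.isCP.conjMap C, ?_, fun i j => ?_⟩
  · have : θ 1 = 1 := hθ.1
    rw [conjMap_apply, this, Matrix.mul_one, ← hC]
  · rw [conjMap_apply, hθY, Matrix.mul_assoc, Matrix.mul_assoc, Matrix.mul_assoc, h2,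
      Matrix.mul_one, ← Matrix.mul_assoc, h2', Matrix.one_mul]

/-- The sum of the diagonal blocks (`none`) and the blocks in the upper right corner
(`some (i, j)`) of a `2n × 2n` block matrix. -/
def blockMap (n k : ℕ) :
    Matrix ((Fin n × Fin k) ⊕ (Fin n × Fin k)) ((Fin n × Fin k) ⊕ (Fin n × Fin k)) ℂ →ₗ[ℂ]
      (Option (Fin n × Fin n) → Fin k → Fin k → ℂ) where
  toFun R o a b := o.elim
    (∑ i, (R (Sum.inl (i, a)) (Sum.inl (i, b)) + R (Sum.inr (i, a)) (Sum.inr (i, b))))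
    fun ij => R (Sum.inl (ij.1, a)) (Sum.inr (ij.2, b))
  map_add' R R' := by
    funext o a b
    rcases o with _ | ij
    · simp only [Option.elim_none, Matrix.add_apply, Pi.add_apply, ← Finset.sum_add_distrib]
      exact Finset.sum_congr rfl fun i _ => by ring
    · rfl
  map_smul' c R := by
    funext o a b
    rcases o with _ | ij
    · simp only [Option.elim_none, Matrix.smul_apply, Pi.smul_apply, smul_eq_mul, ← mul_add,
        ← Finset.mul_sum, RingHom.id_apply]
    · rfl

/-- The image of the positive cone under `blockMap`. -/
def blockCone (n k : ℕ) : Set (Option (Fin n × Fin n) → Fin k → Fin k → ℂ) :=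
  blockMap n k '' {R | R.PosSemidef}

theorem convex_blockCone (n k : ℕ) : Convex ℝ (blockCone n k) := by
  have : Convex ℝ {R : Matrix ((Fin n × Fin k) ⊕ (Fin n × Fin k))
      ((Fin n × Fin k) ⊕ (Fin n × Fin k)) ℂ | R.PosSemidef} := by
    intro R hR R' hR' a b ha hb _
    exact (hR.smul ha).add (hR'.smul hb)
  exact this.linear_image ((blockMap n k).restrictScalars ℝ)

/-- The cone is closed because the trace of a positive matrix, which bounds its size, can be
recovered from the sum of the diagonal blocks. -/
theorem isClosed_blockCone (n k : ℕ) : IsClosed (blockCone n k) := by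
  refine isClosed_of_closure_subset fun e he => ?_
  let tr : (Option (Fin n × Fin n) → Fin k → Fin k → ℂ) → ℝ := fun e => (∑ a, e none a a).re
  -- `tr (blockMap R)` is the trace of `R`
  have htr : Continuous tr := by fun_prop
  set c := tr e + 1 with hc
  set sq : Matrix ((Fin n × Fin k) ⊕ (Fin n × Fin k)) ((Fin n × Fin k) ⊕ (Fin n × Fin k)) ℂ →
    (Option (Fin n × Fin n) → Fin k → Fin k → ℂ) := fun B =>
      blockMap n k (B.conjTranspose * B) with hsq
  have hq : Continuous (blockMap n k) := by
    refine continuous_pi fun o => continuous_pi fun a => continuous_pi fun b => ?_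
    rcases o with _ | ij
    · change Continuous fun R : Matrix ((Fin n × Fin k) ⊕ (Fin n × Fin k))
        ((Fin n × Fin k) ⊕ (Fin n × Fin k)) ℂ =>
        ∑ i, (R (Sum.inl (i, a)) (Sum.inl (i, b)) + R (Sum.inr (i, a)) (Sum.inr (i, b)))
      fun_prop
    · change Continuous fun R : Matrix ((Fin n × Fin k) ⊕ (Fin n × Fin k))
        ((Fin n × Fin k) ⊕ (Fin n × Fin k)) ℂ => R (Sum.inl (ij.1, a)) (Sum.inr (ij.2, b))
      fun_prop
  have hsqc : Continuous sq := hq.comp (by fun_prop)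
  have htrsq : ∀ B, tr (sq B) = ∑ x, ∑ y, ‖B x y‖ ^ 2 := by
    intro B
    have h1 : ∑ a, sq B none a a = (B.conjTranspose * B).trace := by
      simp only [hsq, blockMap, LinearMap.coe_mk, AddHom.coe_mk, Option.elim_none,
        Matrix.trace, Fintype.sum_sum_type, Fintype.sum_prod_type, Matrix.diag_apply,
        Finset.sum_add_distrib]
      rw [Finset.sum_comm, Finset.sum_comm (γ := Fin k) (f := fun a i =>
        (B.conjTranspose * B) (Sum.inr (i, a)) (Sum.inr (i, a)))]
    have h2 : (B.conjTranspose * B).trace = ((∑ x, ∑ y, ‖B x y‖ ^ 2 : ℝ) : ℂ) := by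
      rw [Matrix.trace, Finset.sum_comm]
      push_cast
      refine Finset.sum_congr rfl fun y _ => ?_
      rw [Matrix.diag_apply, Matrix.mul_apply]
      refine Finset.sum_congr rfl fun x _ => ?_
      rw [Matrix.conjTranspose_apply, Complex.star_def, Complex.conj_mul']
    change (∑ a, sq B none a a).re = _
    rw [h1, h2, Complex.ofReal_re]
  let K : Set (Matrix ((Fin n × Fin k) ⊕ (Fin n × Fin k)) ((Fin n × Fin k) ⊕ (Fin n × Fin k)) ℂ) :=
    Set.pi Set.univ fun _ => Set.pi Set.univ fun _ => Metric.closedBall 0 (|c| + 1)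
  have hK : IsCompact K :=
    isCompact_univ_pi fun _ => isCompact_univ_pi fun _ => isCompact_closedBall _ _
  have hsub : blockCone n k ∩ {e' | tr e' < c} ⊆ sq '' K := by
    rintro _ ⟨⟨R, hR, rfl⟩, ht⟩
    obtain ⟨B, rfl⟩ := posSemidef_iff_exists_eq_conjTranspose_mul.1 hR
    refine ⟨B, fun x _ y _ => ?_, rfl⟩
    have h1 : ‖B x y‖ ^ 2 ≤ tr (sq B) := by
      rw [htrsq]
      refine le_trans ?_ (Finset.single_le_sum (f := fun x => ∑ y, ‖B x y‖ ^ 2)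
        (fun _ _ => by positivity) (Finset.mem_univ x))
      exact Finset.single_le_sum (f := fun y => ‖B x y‖ ^ 2)
        (fun _ _ => by positivity) (Finset.mem_univ y)
    have h2 : ‖B x y‖ ^ 2 < c := h1.trans_lt ht
    rw [mem_closedBall_zero_iff]
    nlinarith [le_abs_self c, abs_nonneg c]
  have he' : e ∈ closure (blockCone n k ∩ {e' | tr e' < c}) := by
    rw [Set.inter_comm]
    exact (isOpen_lt htr continuous_const).inter_closure ⟨by simp [hc], he⟩
  have := closure_mono hsub he'
  rw [(hK.image hsqc).isClosed.closure_eq] at this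
  obtain ⟨B, -, rfl⟩ := this
  exact ⟨_, Matrix.posSemidef_conjTranspose_mul_self B, rfl⟩

/-- The duality behind the lifting: a Hermitian datum on which all completely positive maps are
nonnegative comes from a positive block matrix. A functional separating it from `blockCone` is, up
to a small perturbation, given by a completely positive map. -/
theorem mem_blockCone {n k : ℕ} (hn : 1 ≤ n) (e : Option (Fin n × Fin n) → Fin k → Fin k → ℂ)
    (he : ∀ a b, star (e none a b) = e none b a)
    (h : ∀ θ : Unc.{w} n →ₗ[ℂ] Matrix (Fin k) (Fin k) ℂ, IsCP θ →
      0 ≤ (∑ a, ∑ b, (e none a b * θ 1 a b +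
        2 * ∑ ij : Fin n × Fin n, e (some ij) a b * θ (Unc.u n ij.1 ij.2) a b)).re) :
    e ∈ blockCone n k := by
  by_contra hcon
  obtain ⟨f, u, hfu, hue⟩ := RCLike.geometric_hahn_banach_closed_point (𝕜 := ℂ)
    (convex_blockCone n k) (isClosed_blockCone n k) hcon
  simp only [RCLike.re_to_complex] at hfu hue
  have hf0 : ∀ R, R.PosSemidef → (f (blockMap n k R)).re ≤ 0 := by
    intro R hR
    by_contra hlt
    push Not at hlt
    obtain ⟨N, hN⟩ := exists_nat_gt (u / (f (blockMap n k R)).re)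
    have h1 := hfu _ ⟨(N : ℝ) • R, hR.smul (by positivity : (0 : ℝ) ≤ N), rfl⟩
    have h2 : f (blockMap n k ((N : ℝ) • R)) = N * f (blockMap n k R) := by
      have : ((N : ℝ) • R) = (N : ℂ) • R := by ext; simp
      rw [this, map_smul, map_smul, smul_eq_mul]
    rw [h2, Complex.mul_re] at h1
    simp only [Complex.natCast_re, Complex.natCast_im, zero_mul, sub_zero] at h1
    rw [div_lt_iff₀ hlt] at hN
    linarith
  have hu : 0 < u := by
    have := hfu 0 ⟨0, Matrix.PosSemidef.zero, map_zero _⟩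
    simpa using this
  -- the coefficients of the functional
  let F : Option (Fin n × Fin n) → Fin k → Fin k → ℂ := fun o a b =>
    f (Pi.single o (Pi.single a (Pi.single b 1)))
  have hF : ∀ x, f x = ∑ o, ∑ a, ∑ b, x o a b * F o a b := by
    intro x
    have hx : x = ∑ o, ∑ a, ∑ b, x o a b •
        (Pi.single o (Pi.single a (Pi.single b 1)) :
          Option (Fin n × Fin n) → Fin k → Fin k → ℂ) := by
      funext o a b
      simp only [Finset.sum_apply, Pi.smul_apply, smul_eq_mul]
      rw [Finset.sum_eq_single o, Finset.sum_eq_single a, Finset.sum_eq_single b] <;>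
        simp +contextual [Pi.single_apply, ne_comm]
    conv_lhs => rw [hx]
    simp only [map_sum, map_smul, smul_eq_mul]
    rfl
  let α : Matrix (Fin k) (Fin k) ℂ := Matrix.of fun a b => -(F none a b + star (F none b a))
  let H : Fin n → Fin n → Matrix (Fin k) (Fin k) ℂ := fun i j =>
    Matrix.of fun a b => -F (some (i, j)) a b
  have hαs : α.conjTranspose = α := by
    ext a b
    simp [α, add_comm]
  set M₀ := Matrix.fromBlocks ((1 : Matrix (Fin n) (Fin n) ℂ) ⊗ₖ α)
      (Matrix.comp _ _ _ _ ℂ (Matrix.of H)) (Matrix.comp _ _ _ _ ℂ (Matrix.of H)).conjTranspose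
      ((1 : Matrix (Fin n) (Fin n) ℂ) ⊗ₖ α) with hM₀
  have hM₀p : M₀.PosSemidef := by
    refine Matrix.PosSemidef.of_dotProduct_mulVec_nonneg ?_ fun x => ?_
    · rw [Matrix.IsHermitian, hM₀, Matrix.fromBlocks_conjTranspose, Matrix.conjTranspose_kronecker,
        hαs]
      simp
    · -- the quadratic form is `-2 Re f` at the positive matrix `(conj x_s * x_t)`
      have hR : (Matrix.vecMulVec (star x) x).PosSemidef := Matrix.posSemidef_vecMulVec_star_self x
      have h1 := hf0 _ hR
      set z := f (blockMap n k (Matrix.vecMulVec (star x) x)) with hz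
      have h2 : star x ⬝ᵥ M₀.mulVec x = -(z + star z) := by
        set p : Fin n → Fin k → ℂ := fun i a => x (Sum.inl (i, a)) with hp
        set q : Fin n → Fin k → ℂ := fun i a => x (Sum.inr (i, a)) with hq
        have hzz : z = ∑ a, ∑ b, ∑ i, (star (p i a) * p i b + star (q i a) * q i b) * F none a b +
            ∑ i, ∑ j, ∑ a, ∑ b, star (p i a) * q j b * F (some (i, j)) a b := by
          rw [hz, hF, Fintype.sum_option, Fintype.sum_prod_type]
          simp only [blockMap, LinearMap.coe_mk, AddHom.coe_mk, Option.elim_none, Option.elim_some,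
            Matrix.vecMulVec_apply, Finset.sum_mul]
          rfl
        have hsz : star z = ∑ a, ∑ b, ∑ i,
              (star (p i a) * p i b + star (q i a) * q i b) * star (F none b a) +
            ∑ i, ∑ j, ∑ a, ∑ b, p i a * star (q j b) * star (F (some (i, j)) a b) := by
          rw [hzz]
          simp only [star_add, star_sum, star_mul', star_star]
          congr 1
          rw [Finset.sum_comm]
          refine Finset.sum_congr rfl fun a _ => Finset.sum_congr rfl fun b _ =>
            Finset.sum_congr rfl fun i _ => by ring
        have hl : star x ⬝ᵥ M₀.mulVec x =
            ∑ a, ∑ b, ∑ i, (star (p i a) * p i b + star (q i a) * q i b) * α a b +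
            (∑ i, ∑ j, ∑ a, ∑ b, star (p i a) * q j b * H i j a b +
            ∑ i, ∑ j, ∑ a, ∑ b, p i a * star (q j b) * star (H i j a b)) := by
          simp only [dotProduct, Matrix.mulVec, Fintype.sum_sum_type, Fintype.sum_prod_type, hM₀,
            Matrix.fromBlocks_apply₁₁, Matrix.fromBlocks_apply₁₂, Matrix.fromBlocks_apply₂₁,
            Matrix.fromBlocks_apply₂₂, Matrix.kroneckerMap_apply, Matrix.one_apply, ite_mul,
            zero_mul, one_mul, Matrix.conjTranspose_apply, Matrix.comp_apply, Matrix.of_apply,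
            Pi.star_apply]
          have hd : ∀ (g : Fin n → Fin k → ℂ) (i : Fin n) (a : Fin k),
              (∑ j, ∑ b, if i = j then α a b * g j b else 0) = ∑ b, α a b * g i b := by
            intro g i a
            rw [Finset.sum_comm]
            simp
          have h3 : ∀ g : Fin n → Fin k → ℂ, ∑ a, ∑ b, ∑ i, star (g i a) * g i b * α a b =
              ∑ i, ∑ a, star (g i a) * ∑ b, α a b * g i b := by
            intro g
            simp only [Finset.mul_sum]
            rw [Finset.sum_comm_cycle]
            exact Finset.sum_congr rfl fun i _ => Finset.sum_congr rfl fun a _ =>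
              Finset.sum_congr rfl fun b _ => by ring
          have h4 : ∑ i, ∑ j, ∑ a, ∑ b, star (p i a) * q j b * H i j a b =
              ∑ i, ∑ a, star (p i a) * ∑ j, ∑ b, H i j a b * q j b := by
            simp only [Finset.mul_sum]
            refine Finset.sum_congr rfl fun i _ => Finset.sum_comm.trans ?_
            exact Finset.sum_congr rfl fun a _ => Finset.sum_congr rfl fun j _ =>
              Finset.sum_congr rfl fun b _ => by ring
          have h5 : ∑ i, ∑ j, ∑ a, ∑ b, p i a * star (q j b) * star (H i j a b) =
              ∑ j, ∑ b, star (q j b) * ∑ i, ∑ a, star (H i j a b) * p i a := by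
            simp only [Finset.mul_sum]
            refine Finset.sum_comm.trans (Finset.sum_congr rfl fun j _ => ?_)
            rw [Finset.sum_comm_cycle]
            exact Finset.sum_congr rfl fun b _ => Finset.sum_congr rfl fun i _ =>
              Finset.sum_congr rfl fun a _ => by ring
          rw [h4, h5]
          simp only [add_mul, Finset.sum_add_distrib, h3]
          simp only [mul_add, Finset.sum_add_distrib, hd fun i a => x (Sum.inl (i, a)),
            hd fun i a => x (Sum.inr (i, a))]
          simp only [hp, hq]
          ring
        rw [hl, hsz, hzz]
        simp only [α, H, Matrix.of_apply, star_neg, mul_neg, mul_add, Finset.sum_neg_distrib,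
          Finset.sum_add_distrib]
        ring
      rw [h2, Complex.star_def, Complex.add_conj]
      rw [← Complex.ofReal_neg]
      exact Complex.zero_le_real.2 (by linarith)
  -- `α` is a diagonal block of `M₀`; this needs `n ≠ 0`
  have hαp : α.PosSemidef := by
    have := hM₀p.submatrix (fun a : Fin k => Sum.inl ((⟨0, hn⟩ : Fin n), a))
    convert this using 1
    ext a b
    simp [hM₀]
  -- adding `η` makes `α` invertible
  have hη : ∀ η : ℝ, 0 < η → 0 ≤ -2 * (f e).re + η * (∑ a, e none a a).re := by
    intro η hη
    have hα' : (α + (η : ℂ) • 1).PosDef :=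
      Matrix.PosDef.posSemidef_add hαp (Matrix.PosDef.one.smul (by exact_mod_cast hη))
    obtain ⟨θ, hθ, hθ1, hθu⟩ := exists_isCP_unc.{w} hα' H (by
      have := hM₀p.add (Matrix.PosSemidef.one.smul (a := (η : ℂ)) (by exact_mod_cast hη.le))
      convert this using 1
      rw [hM₀, ← Matrix.fromBlocks_one, Matrix.fromBlocks_smul, Matrix.fromBlocks_add,
        Matrix.kronecker_add, Matrix.kronecker_smul]
      simp)
    have h1 := h θ hθ
    rw [hθ1] at h1
    simp only [hθu] at h1
    convert h1 using 1
    have hfe : f e = ∑ a, ∑ b, e none a b * F none a b +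
        ∑ a, ∑ b, ∑ ij : Fin n × Fin n, e (some ij) a b * F (some ij) a b := by
      rw [hF, Fintype.sum_option]
      congr 1
      rw [Finset.sum_comm]
      exact Finset.sum_congr rfl fun a _ => Finset.sum_comm
    have hre : (∑ a, ∑ b, e none a b * star (F none b a)).re =
        (∑ a, ∑ b, e none a b * F none a b).re := by
      rw [Finset.sum_comm, ← Complex.conj_re]
      simp only [map_sum, map_mul, ← Complex.star_def, star_star, he]
    have hsum : (∑ a, ∑ b, (e none a b * (α + (η : ℂ) • 1) a b +
          2 * ∑ ij : Fin n × Fin n, e (some ij) a b * H ij.1 ij.2 a b)) =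
        -(∑ a, ∑ b, e none a b * F none a b) - (∑ a, ∑ b, e none a b * star (F none b a)) -
          2 * (∑ a, ∑ b, ∑ ij : Fin n × Fin n, e (some ij) a b * F (some ij) a b) +
          η * ∑ a, e none a a := by
      have h3 : η * ∑ a, e none a a =
          ∑ a, ∑ b, e none a b * ((η : ℂ) • (1 : Matrix _ _ ℂ)) a b := by
        rw [Finset.mul_sum]
        refine Finset.sum_congr rfl fun a _ => ?_
        simp [Matrix.one_apply, mul_comm]
      rw [h3]
      simp only [Finset.mul_sum, ← Finset.sum_neg_distrib, ← Finset.sum_sub_distrib,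
        ← Finset.sum_add_distrib]
      refine Finset.sum_congr rfl fun a _ => Finset.sum_congr rfl fun b _ => ?_
      simp only [Matrix.add_apply, α, H, Matrix.of_apply, mul_neg, Finset.sum_neg_distrib]
      ring
    rw [hsum, hfe]
    simp only [Complex.add_re, Complex.sub_re, Complex.neg_re, Complex.mul_re, hre,
      Complex.ofReal_re, Complex.ofReal_im, zero_mul, sub_zero, Complex.re_ofNat, Complex.im_ofNat]
    ring
  have h1 : (f e).re ≤ 0 := by
    by_contra hlt
    push Not at hlt
    set t := (∑ a, e none a a).re
    have := hη ((f e).re / (|t| + 1)) (by positivity)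
    have h2 : (f e).re / (|t| + 1) * t ≤ (f e).re := by
      rw [div_mul_eq_mul_div, div_le_iff₀ (by positivity)]
      nlinarith [le_abs_self t]
    linarith
  linarith

end Lifting

/-! ### Matrices over `V_n` -/

section MatricesVn

/-- The generator `u_{ij}` as an element of `V_n`. -/
def Vn.u (n : ℕ) (i j : Fin n) : Vn.{w} n :=
  ⟨Unc.u n i j, Submodule.subset_span (Or.inl (Or.inr ⟨(i, j), rfl⟩))⟩

theorem Vn.coe_unit (n : ℕ) : ((unit : Vn.{w} n) : Unc.{w} n) = 1 := rfl

theorem Vn.coe_u (n : ℕ) (i j : Fin n) : (Vn.u.{w} n i j : Unc.{w} n) = Unc.u n i j := rfl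

theorem Vn.coe_star {n : ℕ} (x : Vn.{w} n) : ((star x : Vn.{w} n) : Unc.{w} n) = star (x : Unc n) :=
  rfl

theorem Vn.exists_eq_sum {n : ℕ} (x : Vn.{w} n) : ∃ (a : ℂ) (b c : Fin n → Fin n → ℂ),
    x = a • unit + ∑ i, ∑ j, b i j • Vn.u n i j + ∑ i, ∑ j, c i j • star (Vn.u n i j) := by
  obtain ⟨x, hx⟩ := x
  induction hx using Submodule.span_induction with
  | mem x hx =>
    rcases hx with (rfl | ⟨ij, rfl⟩) | ⟨ij, rfl⟩
    · exact ⟨1, 0, 0, by simp; rfl⟩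
    · refine ⟨0, fun i j => if (i, j) = ij then 1 else 0, 0, ?_⟩
      rw [← Finset.sum_product', ← Finset.univ_product_univ.symm]
      simp
      rfl
    · refine ⟨0, 0, fun i j => if (i, j) = ij then 1 else 0, ?_⟩
      rw [← Finset.sum_product' (f := fun i j =>
        (if (i, j) = ij then (1 : ℂ) else 0) • star (Vn.u n i j)), ← Finset.univ_product_univ.symm]
      simp
      rfl
  | zero => exact ⟨0, 0, 0, by simp; rfl⟩
  | add x y hx hy ihx ihy =>
    obtain ⟨a, b, c, h⟩ := ihx
    obtain ⟨a', b', c', h'⟩ := ihy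
    refine ⟨a + a', b + b', c + c', ?_⟩
    have : (⟨x + y, Submodule.add_mem _ hx hy⟩ : Vn.{w} n) = ⟨x, hx⟩ + ⟨y, hy⟩ := rfl
    rw [this, h, h']
    simp only [Pi.add_apply, add_smul, Finset.sum_add_distrib]
    abel
  | smul t x hx ih =>
    obtain ⟨a, b, c, h⟩ := ih
    refine ⟨t * a, fun i j => t * b i j, fun i j => t * c i j, ?_⟩
    have : (⟨t • x, Submodule.smul_mem _ t hx⟩ : Vn.{w} n) = t • ⟨x, hx⟩ := rfl
    rw [this, h]
    simp only [smul_add, Finset.smul_sum, smul_smul]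

/-- A self-adjoint matrix over `V_n` is determined by the Hermitian coefficient matrix of `1` and
the coefficient matrices of the `u_{ij}`. -/
theorem Vn.exists_eq_sum_of_conjTranspose_eq {n k : ℕ} {P : Matrix (Fin k) (Fin k) (Vn.{w} n)}
    (hP : P.conjTranspose = P) : ∃ e : Option (Fin n × Fin n) → Fin k → Fin k → ℂ,
      (∀ a b, star (e none a b) = e none b a) ∧
      ∀ a b, P a b = e none a b • unit + ∑ i, ∑ j, e (some (i, j)) a b • Vn.u n i j +
        ∑ i, ∑ j, star (e (some (i, j)) b a) • star (Vn.u n i j) := by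
  choose c B D h using fun a b => Vn.exists_eq_sum (P a b)
  refine ⟨fun o a b => o.elim (1 / 2 * (c a b + star (c b a)))
    fun ij => 1 / 2 * (B a b ij.1 ij.2 + star (D b a ij.1 ij.2)), fun a b => ?_, fun a b => ?_⟩
  · simp [add_comm]
  · have h1 : P a b = (1 / 2 : ℂ) • (P a b + star (P b a)) := by
      have : star (P b a) = P a b := congrFun (congrFun hP a) b
      rw [this, ← two_smul ℂ, smul_smul]
      norm_num
    rw [h1]
    conv_lhs => rw [h a b, h b a]
    simp only [star_add, star_sum, star_smul, star_star, star_unit, Option.elim_none,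
      Option.elim_some, star_mul', mul_add, smul_add, add_smul, Finset.smul_sum, smul_smul,
      Finset.sum_add_distrib]
    have : star (1 / 2 : ℂ) = 1 / 2 := by simp
    rw [this]
    abel

theorem sum_sum_nonneg_of_posSemidef {k : ℕ} {M : Matrix (Fin k × Fin k) (Fin k × Fin k) ℂ}
    (hM : M.PosSemidef) : 0 ≤ ∑ a, ∑ b, M (a, a) (b, b) := by
  have := hM.dotProduct_mulVec_nonneg (fun x => if x.1 = x.2 then 1 else 0)
  convert this using 1
  simp [dotProduct, Matrix.mulVec, Fintype.sum_prod_type]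

/-- The map from `M_{2n}` onto `V_n` lifts positive matrices to positive matrices. -/
theorem Vn.exists_posSemidef_lift {n k : ℕ} (hn : 1 ≤ n) {P : Matrix (Fin k) (Fin k) (Vn.{w} n)}
    (hP : P ∈ cone k) :
    ∃ R : Matrix ((Fin n × Fin k) ⊕ (Fin n × Fin k)) ((Fin n × Fin k) ⊕ (Fin n × Fin k)) ℂ,
      R.PosSemidef ∧ ∀ a b, P a b =
        (∑ i, (R (Sum.inl (i, a)) (Sum.inl (i, b)) + R (Sum.inr (i, a)) (Sum.inr (i, b)))) • unit +
        ∑ i, ∑ j, R (Sum.inl (i, a)) (Sum.inr (j, b)) • Vn.u n i j +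
        ∑ i, ∑ j, R (Sum.inr (i, a)) (Sum.inl (j, b)) • star (Vn.u n j i) := by
  obtain ⟨e, he, hPe⟩ := Vn.exists_eq_sum_of_conjTranspose_eq (OperatorSystem.conjTranspose_eq hP)
  have hmem : e ∈ blockCone n k := by
    refine mem_blockCone.{w} hn e he fun θ hθ => ?_
    have h1 := sum_sum_nonneg_of_posSemidef (hθ k _ hP)
    have h2 : ∑ a, ∑ b, Matrix.comp (Fin k) (Fin k) (Fin k) (Fin k) ℂ
        ((P.map (vnSubspace n).subtype).map θ) (a, a) (b, b) =
        ∑ a, ∑ b, e none a b * θ 1 a b +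
        (∑ a, ∑ b, ∑ ij : Fin n × Fin n, e (some ij) a b * θ (Unc.u n ij.1 ij.2) a b +
        star (∑ a, ∑ b, ∑ ij : Fin n × Fin n, e (some ij) a b * θ (Unc.u n ij.1 ij.2) a b)) := by
      have hcomp : ∀ a b, Matrix.comp (Fin k) (Fin k) (Fin k) (Fin k) ℂ
          ((P.map (vnSubspace n).subtype).map θ) (a, a) (b, b) =
          e none a b * θ 1 a b +
          (∑ ij : Fin n × Fin n, e (some ij) a b * θ (Unc.u n ij.1 ij.2) a b +
          ∑ ij : Fin n × Fin n, star (e (some ij) b a) * star (θ (Unc.u n ij.1 ij.2) b a)) := by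
        intro a b
        change θ (P a b : Unc.{w} n) a b = _
        rw [hPe]
        simp only [Submodule.coe_add, Submodule.coe_smul, Submodule.coe_sum, Vn.coe_unit, Vn.coe_u,
          Vn.coe_star, map_add, map_sum, map_smul, hθ.map_star, Matrix.add_apply, Matrix.sum_apply,
          Matrix.smul_apply, smul_eq_mul, Matrix.conjTranspose_apply, Fintype.sum_prod_type]
        ring
      simp only [hcomp, Finset.sum_add_distrib, star_sum, star_mul']
      congr 2
      rw [Finset.sum_comm]
    rw [h2] at h1
    have h3 := (Complex.nonneg_iff.1 h1).1
    convert h3 using 1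
    simp only [Finset.sum_add_distrib, ← Finset.mul_sum, Complex.add_re, Complex.mul_re,
      Complex.star_def, Complex.conj_re, Complex.re_ofNat, Complex.im_ofNat]
    ring
  obtain ⟨R, hR, rfl⟩ := hmem
  refine ⟨R, hR, fun a b => ?_⟩
  rw [hPe]
  congr 1
  rw [Finset.sum_comm]
  refine Finset.sum_congr rfl fun i _ => Finset.sum_congr rfl fun j _ => ?_
  rw [← hR.isHermitian.apply]
  rfl

/-- A unital functional on `U_nc(n)` whose only nonzero value on the generators is `z` at `u_{ij}`;
it exists since `z E_{ij}` is a contraction. -/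
theorem Unc.exists_matrixState_single {n : ℕ} (i j : Fin n) (z : ℂ) (hz : ‖z‖ ≤ 1) :
    ∃ θ : Unc.{w} n →ₗ[ℂ] ℂ, θ 1 = 1 ∧
      (∀ k l, θ (Unc.u n k l) = if i = k ∧ j = l then z else 0) ∧
      ∀ k l, θ (star (Unc.u n k l)) = if i = k ∧ j = l then star z else 0 := by
  obtain ⟨θ, hθ, hθu⟩ := exists_matrixState_unc.{w} (n := n) (k := 1)
    (fun k l => Matrix.of fun _ _ => if i = k ∧ j = l then z else 0) (by
      set Y := Matrix.single ((i, 0) : Fin n × Fin 1) ((j, 0) : Fin n × Fin 1) z with hYdef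
      have hY : Matrix.comp (Fin n) (Fin n) (Fin 1) (Fin 1) ℂ (Matrix.of fun k l =>
          Matrix.of fun _ _ => if i = k ∧ j = l then z else 0) = Y := by
        ext ⟨k, a⟩ ⟨l, b⟩
        have ha := Subsingleton.elim a 0
        have hb := Subsingleton.elim b 0
        subst ha hb
        simp [hYdef, Matrix.single_apply]
      rw [hY]
      let _ : Invertible (1 : Matrix (Fin n × Fin 1) (Fin n × Fin 1) ℂ) := invertibleOne
      rw [Matrix.PosDef.fromBlocks₁₁ _ _ Matrix.PosDef.one]
      have : 1 - Y.conjTranspose * (1 : Matrix (Fin n × Fin 1) (Fin n × Fin 1) ℂ)⁻¹ * Y =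
          Matrix.diagonal fun x => if x = (j, 0) then ((1 - ‖z‖ ^ 2 : ℝ) : ℂ) else 1 := by
        rw [inv_one, Matrix.mul_one, hYdef, Matrix.conjTranspose_single,
          Matrix.single_mul_single_same]
        ext x y
        by_cases hxy : x = y
        · subst hxy
          by_cases hx : x = (j, 0)
          · subst hx
            simp [Complex.conj_mul']
          · simp [hx, Ne.symm hx]
        · have : ¬((j, 0) = x ∧ (j, 0) = y) := fun h => hxy (h.1.symm.trans h.2)
          simp [hxy, this]
      rw [this, Matrix.posSemidef_diagonal_iff]
      intro x
      split_ifs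
      · rw [Complex.zero_le_real]
        nlinarith [norm_nonneg z]
      · exact zero_le_one)
  refine ⟨(Matrix.entryLinearMap ℂ ℂ 0 0).comp θ, ?_, fun k l => ?_, fun k l => ?_⟩
  · have : θ 1 = 1 := hθ.1
    simp [this]
  · simp [hθu]
  · simp only [LinearMap.comp_apply, Matrix.entryLinearMap_apply, hθ.isCP.map_star, hθu,
      Matrix.conjTranspose_apply, Matrix.of_apply]
    split_ifs <;> simp

/-- Coefficient functionals for the family `1`, `u_{ij}`, `u_{ij}^*`, which is therefore linearly
independent. -/
theorem Unc.exists_coeff {n : ℕ} (hn : 1 ≤ n) :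
    ∃ (c₀ : Unc.{w} n →ₗ[ℂ] ℂ) (c d : Fin n → Fin n → Unc.{w} n →ₗ[ℂ] ℂ),
      (c₀ 1 = 1 ∧ (∀ k l, c₀ (Unc.u n k l) = 0) ∧ ∀ k l, c₀ (star (Unc.u n k l)) = 0) ∧
      (∀ i j, c i j 1 = 0 ∧ (∀ k l, c i j (Unc.u n k l) = if i = k ∧ j = l then 1 else 0) ∧
        ∀ k l, c i j (star (Unc.u n k l)) = 0) ∧
      ∀ i j, d i j 1 = 0 ∧ (∀ k l, d i j (Unc.u n k l) = 0) ∧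
        ∀ k l, d i j (star (Unc.u n k l)) = if i = k ∧ j = l then 1 else 0 := by
  obtain ⟨θ₀, h₀, h₀u, h₀s⟩ := Unc.exists_matrixState_single.{w} (⟨0, hn⟩ : Fin n) ⟨0, hn⟩ 0
    (by simp)
  simp only [star_zero, ite_self] at h₀u h₀s
  choose θ₁ h₁ h₁u h₁s using fun i j : Fin n =>
    Unc.exists_matrixState_single.{w} i j 1 (by simp)
  choose θ₂ h₂ h₂u h₂s using fun i j : Fin n =>
    Unc.exists_matrixState_single.{w} i j Complex.I (by simp)
  -- `z ↦ z` and `z ↦ star z` are separated by averaging over `z = 1` and `z = I`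
  refine ⟨θ₀, fun i j => (1 / 2 : ℂ) • ((θ₁ i j - θ₀) - Complex.I • (θ₂ i j - θ₀)),
    fun i j => (1 / 2 : ℂ) • ((θ₁ i j - θ₀) + Complex.I • (θ₂ i j - θ₀)),
    ⟨h₀, h₀u, h₀s⟩, fun i j => ⟨?_, fun k l => ?_, fun k l => ?_⟩,
    fun i j => ⟨?_, fun k l => ?_, fun k l => ?_⟩⟩ <;>
  simp only [LinearMap.smul_apply, LinearMap.add_apply, LinearMap.sub_apply, h₀, h₁, h₂, h₀u, h₁u,
    h₂u, h₀s, h₁s, h₂s] <;>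
  (try split_ifs) <;> norm_num

end MatricesVn

/-! ### Positivity of compressions and tensor products -/

section TensorPositivity

variable {S : Type u} [AddCommGroup S] [Module ℂ S] [StarAddMonoid S] [StarModule ℂ S]
  [OperatorSystem S]
variable {T : Type v} [AddCommGroup T] [Module ℂ T] [StarAddMonoid T] [StarModule ℂ T]
  [OperatorSystem T]
variable {ι κ : Type*} [Fintype ι] [Fintype κ]

theorem IsPos.submatrix_equiv {X : Matrix ι ι S} (hX : IsPos X) (e : κ ≃ ι) :
    IsPos (X.submatrix e e) := by
  obtain ⟨k, f, h⟩ := hX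
  refine ⟨k, e.trans f, ?_⟩
  convert h using 1
  ext a b
  simp

theorem isPos_comp_iff {p : ℕ} {X : Matrix ι ι (Matrix (Fin p) (Fin p) S)} :
    IsPos X ↔ IsPos (Matrix.comp ι ι (Fin p) (Fin p) S X) := by
  have e := Fintype.equivFin ι
  rw [isPos_iff e]
  constructor
  · intro h
    have h' : IsPos (Matrix.comp _ _ (Fin p) (Fin p) S (X.submatrix e.symm e.symm)) := h
    convert h'.submatrix_equiv (e.prodCongr (Equiv.refl (Fin p))) using 1
    ext ⟨a, i⟩ ⟨b, j⟩
    simp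
  · intro h
    exact h.submatrix_equiv (e.symm.prodCongr (Equiv.refl (Fin p)))

theorem IsPos.sum {τ : Type*} (s : Finset τ) {X : τ → Matrix ι ι S} (h : ∀ t ∈ s, IsPos (X t)) :
    IsPos (∑ t ∈ s, X t) := by
  classical
  induction s using Finset.induction_on with
  | empty =>
    obtain ⟨r, -, h⟩ := exists_isPos_add (0 : Matrix ι ι S) (by simp)
    simpa using h.smul le_rfl
  | insert t s ht ih =>
    rw [Finset.sum_insert ht]
    exact (h t (Finset.mem_insert_self t s)).add
      (ih fun t' ht' => h t' (Finset.mem_insert_of_mem ht'))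

/-- The tensor product of a positive scalar matrix with a positive matrix over `S`. -/
theorem IsPos.scalar_kronecker {R : Matrix κ κ ℂ} (hR : R.PosSemidef) {Q : Matrix ι ι S}
    (hQ : IsPos Q) : IsPos (Matrix.kroneckerMap (fun (r : ℂ) (s : S) => r • s) R Q) := by
  classical
  obtain ⟨B, rfl⟩ := posSemidef_iff_exists_eq_conjTranspose_mul.1 hR
  have h := IsPos.sum Finset.univ fun t (_ : t ∈ Finset.univ) =>
    hQ.compress (Matrix.of fun (μ : ι) (x : κ × ι) => if μ = x.2 then B t x.1 else 0)
  convert h using 1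
  ext ⟨x, μ⟩ ⟨y, ν⟩
  simp [OpSys.compress, Matrix.sum_apply, Matrix.mul_apply, Finset.sum_smul, apply_ite, ite_smul]

theorem posSemidef_sum_sum {τ : Type*} [Fintype τ] {M : Matrix ι ι ℂ} (hM : M.PosSemidef)
    (g : τ → κ → ι) : (Matrix.of fun x y => ∑ a, ∑ b, M (g a x) (g b y)).PosSemidef := by
  obtain ⟨B, rfl⟩ := posSemidef_iff_exists_eq_conjTranspose_mul.1 hM
  have := Matrix.posSemidef_conjTranspose_mul_self
    (Matrix.of fun (i : ι) (x : κ) => ∑ a, B i (g a x))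
  convert this using 1
  ext x y
  simp only [Matrix.mul_apply, Matrix.of_apply, Matrix.conjTranspose_apply, star_sum,
    Finset.sum_mul_sum]
  rw [Finset.sum_comm_cycle]

theorem mem_maxPreCone {n : ℕ} {P : Matrix ι ι S} {Q : Matrix κ κ T} (hP : IsPos P) (hQ : IsPos Q)
    (A : Matrix (Fin n) (ι × κ) ℂ) :
    compress A.conjTranspose (Matrix.kroneckerMap (fun s t => s ⊗ₜ[ℂ] t) P Q) ∈
      maxPreCone S T n := by
  obtain ⟨k, e, h⟩ := hP
  obtain ⟨m, f, h'⟩ := hQ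
  refine ⟨k, m, _, _, A.submatrix id (e.prodCongr f).symm, h, h', ?_⟩
  have := compress_submatrix A.conjTranspose (Matrix.kroneckerMap (fun s t => s ⊗ₜ[ℂ] t) P Q)
    (e.prodCongr f) (Equiv.refl (Fin n))
  exact this.symm

theorem comp_map_compress [DecidableEq ι] {V : Type*} [AddCommGroup V] [Module ℂ V] {τ : Type*}
    [Fintype τ] (f : V →ₗ[ℂ] Matrix ι ι ℂ) (A : Matrix τ κ ℂ) (X : Matrix τ τ V) :
    Matrix.comp κ κ ι ι ℂ ((compress A X).map f) =
      (A ⊗ₖ (1 : Matrix ι ι ℂ)).conjTranspose * Matrix.comp τ τ ι ι ℂ (X.map f) *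
        (A ⊗ₖ (1 : Matrix ι ι ℂ)) := by
  ext ⟨a, i⟩ ⟨b, j⟩
  simp only [Matrix.comp_apply, Matrix.map_apply, OpSys.compress, Matrix.of_apply, map_sum,
    map_smul, Matrix.sum_apply, Matrix.smul_apply, Matrix.mul_apply, Fintype.sum_prod_type,
    Matrix.conjTranspose_apply, Matrix.kroneckerMap_apply, Matrix.one_apply]
  simp [apply_ite, Finset.sum_mul]
  rw [Finset.sum_comm]
  exact Finset.sum_congr rfl fun _ _ => Finset.sum_congr rfl fun _ _ => by ring

theorem posSemidef_of_mem_maxPreCone {n : ℕ} {X : Matrix (Fin n) (Fin n) (S ⊗[ℂ] T)}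
    (hX : X ∈ maxPreCone S T n) {φ : S →ₗ[ℂ] Matrix ι ι ℂ} {ψ : T →ₗ[ℂ] Matrix κ κ ℂ}
    (hφ : IsCP φ) (hψ : IsCP ψ) :
    (Matrix.comp (Fin n) (Fin n) _ _ ℂ (X.map (kronMap φ ψ))).PosSemidef := by
  classical
  obtain ⟨k, m, P, Q, A, hP, hQ, rfl⟩ := hX
  rw [comp_map_compress]
  refine Matrix.PosSemidef.conjTranspose_mul_mul_same ?_ _
  exact ((hφ _ _ hP).kronecker (hψ _ _ hQ)).submatrix
    (fun x : (Fin k × Fin m) × (ι × κ) => ((x.1.1, x.2.1), (x.1.2, x.2.2)))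

theorem maxCone_subset_minCone (n : ℕ) : maxCone S T n ⊆ minCone S T n := by
  refine fun X hX => ⟨hX.1, fun k l φ ψ hφ hψ => ?_⟩
  set M := Matrix.comp (Fin n) (Fin n) _ _ ℂ (X.map (tensorMap φ ψ)) with hM
  have hε : ∀ ε : ℝ, 0 < ε → (M + (ε : ℂ) • 1).PosSemidef := by
    intro ε hε
    have := posSemidef_of_mem_maxPreCone (hX.2 ε hε) hφ.isCP hψ.isCP
    convert this using 1
    ext ⟨a, i⟩ ⟨b, j⟩
    by_cases hab : a = b
    · subst hab
      have h1 : tensorMap φ ψ ((unit : S) ⊗ₜ[ℂ] (unit : T)) = 1 := by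
        rw [tensorMap_eq_kronMap, kronMap_tmul, hφ.1, hψ.1, Matrix.one_kronecker_one]
      simp only [Matrix.add_apply, hM, Matrix.comp_apply, Matrix.map_apply, Matrix.smul_apply,
        Matrix.diagonal_apply_eq, map_add, map_smul, ← tensorMap_eq_kronMap, h1, Matrix.one_apply,
        Prod.mk.injEq, true_and]
    · simp [hM, hab, tensorMap_eq_kronMap]
  refine Matrix.PosSemidef.of_dotProduct_mulVec_nonneg ?_ fun x => ?_
  · have := (hε 1 one_pos).isHermitian.sub (Matrix.isHermitian_one)
    simpa using this
  · have h : ∀ ε : ℝ, 0 < ε → 0 ≤ star x ⬝ᵥ M.mulVec x + ε * (star x ⬝ᵥ x) := by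
      intro ε h
      have := (hε ε h).dotProduct_mulVec_nonneg x
      rwa [Matrix.add_mulVec, dotProduct_add, Matrix.smul_mulVec, Matrix.one_mulVec,
        dotProduct_smul, smul_eq_mul] at this
    have ht : Filter.Tendsto (fun ε : ℝ => star x ⬝ᵥ M.mulVec x + (ε : ℂ) * (star x ⬝ᵥ x))
        (nhdsWithin 0 (Set.Ioi 0)) (nhds (star x ⬝ᵥ M.mulVec x + ((0 : ℝ) : ℂ) * (star x ⬝ᵥ x))) :=
      (Continuous.tendsto (by fun_prop) 0).mono_left nhdsWithin_le_nhds
    rw [Complex.ofReal_zero, zero_mul, add_zero] at ht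
    refine ge_of_tendsto ht ?_
    filter_upwards [self_mem_nhdsWithin] with ε hε using h ε hε

end TensorPositivity

/-! ### Matricial states of `V_n` extend to `U_nc(n)` -/

section Extension

/-- The block matrix `[[1, u], [u^*, 1]]` over `V_n`, the image of the matrix of matrix units
`(E_{ij})` under the map from `M_{2n}` onto `V_n`. -/
def Vn.block (n : ℕ) : Matrix (Fin n ⊕ Fin n) (Fin n ⊕ Fin n) (Vn.{w} n) :=
  Matrix.fromBlocks (Matrix.diagonal fun _ => unit) (Matrix.of fun i j => Vn.u n i j)
    (Matrix.of fun i j => star (Vn.u n j i)) (Matrix.diagonal fun _ => unit)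

theorem Vn.isPos_block (n : ℕ) : IsPos (Vn.block.{w} n) := by
  rw [isPos_iff finSumFinEquiv]
  let Y : Matrix (Fin n ⊕ Fin n) (Fin n ⊕ Fin n) (Unc.{w} n) := Matrix.fromBlocks 1 (Unc.u n) 0 0
  have hY : (Vn.block.{w} n).map (vnSubspace n).subtype = Y.conjTranspose * Y := by
    have hu : (Unc.u.{w} n).conjTranspose * Unc.u n = 1 :=
      (Unitary.mem_iff.1 (Unc.u_mem_unitary n)).1
    rw [Matrix.fromBlocks_conjTranspose, Matrix.fromBlocks_multiply]
    simp only [Matrix.conjTranspose_one, Matrix.conjTranspose_zero, Matrix.mul_zero, add_zero, hu,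
      Matrix.one_mul, Matrix.mul_one]
    ext1 (i | i) (j | j)
    · simp only [Matrix.map_apply, Vn.block, Matrix.fromBlocks_apply₁₁, Matrix.diagonal_apply,
        Matrix.one_apply]
      split_ifs <;> rfl
    · rfl
    · rfl
    · simp only [Matrix.map_apply, Vn.block, Matrix.fromBlocks_apply₂₂, Matrix.diagonal_apply,
        Matrix.one_apply]
      split_ifs <;> rfl
  refine ⟨Y.submatrix finSumFinEquiv.symm finSumFinEquiv.symm, ?_⟩
  rw [Matrix.conjTranspose_submatrix, Matrix.submatrix_mul_equiv, ← hY]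
  rfl

theorem Vn.exists_extension {n k : ℕ} {φ : Vn.{w} n →ₗ[ℂ] Matrix (Fin k) (Fin k) ℂ}
    (hφ : IsMatrixState φ) :
    ∃ θ : Unc.{w} n →ₗ[ℂ] Matrix (Fin k) (Fin k) ℂ, IsMatrixState θ ∧ ∀ x : Vn n, θ x = φ x := by
  obtain ⟨θ, hθ, hθu⟩ := exists_matrixState_unc.{w} (fun i j => φ (Vn.u n i j)) (by
    have := (hφ.isCP.posSemidef_comp (Vn.isPos_block n)).submatrix
      (Equiv.sumProdDistrib (Fin n) (Fin n) (Fin k)).symm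
    convert this using 1
    ext1 (⟨i, a⟩ | ⟨i, a⟩) (⟨j, b⟩ | ⟨j, b⟩)
    · by_cases hij : i = j <;> simp [Vn.block, hij, hφ.1, Matrix.one_apply]
    · simp [Vn.block]
    · simp [Vn.block, hφ.isCP.map_star]
    · by_cases hij : i = j <;> simp [Vn.block, hij, hφ.1, Matrix.one_apply])
  refine ⟨θ, hθ, fun x => ?_⟩
  have h1 : θ 1 = 1 := hθ.1
  obtain ⟨a, b, c, rfl⟩ := Vn.exists_eq_sum x
  simp only [Submodule.coe_add, Submodule.coe_smul, Submodule.coe_sum, Vn.coe_unit, Vn.coe_u,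
    Vn.coe_star, map_add, map_sum, map_smul, h1, hφ.1, hθu, hθ.isCP.map_star, hφ.isCP.map_star]

end Extension

/-! ### The tensor products of `V_n` -/

section TensorVn

variable {S : Type u} [AddCommGroup S] [Module ℂ S] [StarAddMonoid S] [StarModule ℂ S]
  [OperatorSystem S]

/-- The element `1 ⊗ s + ∑ u_{ij} ⊗ P_{ij} + ∑ u_{ji}^* ⊗ N_{ij}` of `V_n ⊗ S`. -/
def vTensor {n : ℕ} (s : S) (P N : Fin n → Fin n → S) : Vn.{w} n ⊗[ℂ] S :=
  unit ⊗ₜ s + ∑ i, ∑ j, Vn.u n i j ⊗ₜ P i j + ∑ i, ∑ j, star (Vn.u n j i) ⊗ₜ N i j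

theorem vTensor_add {n : ℕ} (s s' : S) (P P' N N' : Fin n → Fin n → S) :
    vTensor.{u, w} (s + s') (P + P') (N + N') = vTensor s P N + vTensor s' P' N' := by
  simp only [vTensor, Pi.add_apply, TensorProduct.tmul_add, Finset.sum_add_distrib]
  abel

theorem smul_vTensor {n : ℕ} (c : ℂ) (s : S) (P N : Fin n → Fin n → S) :
    c • vTensor.{u, w} s P N = vTensor (c • s) (c • P) (c • N) := by
  simp only [vTensor, Pi.smul_apply, TensorProduct.tmul_smul, smul_add, Finset.smul_sum]

theorem sum_vTensor {n : ℕ} {τ : Type*} (t : Finset τ) (s : τ → S) (P N : τ → Fin n → Fin n → S) :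
    ∑ x ∈ t, vTensor.{u, w} (s x) (P x) (N x) =
      vTensor (∑ x ∈ t, s x) (∑ x ∈ t, P x) (∑ x ∈ t, N x) := by
  classical
  induction t using Finset.induction_on with
  | empty => simp [vTensor]
  | insert x t hx ih => simp only [Finset.sum_insert hx, ih, vTensor_add]

theorem tmul_eq_vTensor {n : ℕ} (a : ℂ) (b c : Fin n → Fin n → ℂ) (s : S) :
    (a • unit + ∑ i, ∑ j, b i j • Vn.u.{w} n i j + ∑ i, ∑ j, c i j • star (Vn.u n j i)) ⊗ₜ[ℂ] s =
      vTensor (a • s) (fun i j => b i j • s) (fun i j => c i j • s) := by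
  simp only [vTensor, TensorProduct.add_tmul, TensorProduct.sum_tmul, TensorProduct.smul_tmul]

theorem exists_eq_vTensor {n : ℕ} (x : Vn.{w} n ⊗[ℂ] S) :
    ∃ (s : S) (P N : Fin n → Fin n → S), x = vTensor s P N := by
  induction x with
  | zero => exact ⟨0, 0, 0, by simp [vTensor]⟩
  | tmul v s =>
    obtain ⟨a, b, c, rfl⟩ := Vn.exists_eq_sum v
    rw [Finset.sum_comm (f := fun i j => c i j • star (Vn.u n i j))]
    exact ⟨_, _, _, tmul_eq_vTensor a b (fun i j => c j i) s⟩
  | add x y hx hy =>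
    obtain ⟨s, P, N, rfl⟩ := hx
    obtain ⟨s', P', N', rfl⟩ := hy
    exact ⟨_, _, _, (vTensor_add _ _ _ _ _ _).symm⟩

theorem vTensor_injective {n : ℕ} (hn : 1 ≤ n) {s s' : S} {P P' N N' : Fin n → Fin n → S}
    (h : vTensor.{u, w} s P N = vTensor s' P' N') :
    s = s' ∧ (∀ i j, P i j = P' i j) ∧ ∀ i j, N i j = N' i j := by
  obtain ⟨c₀, c, d, ⟨h₀, h₀u, h₀s⟩, hc, hd⟩ := Unc.exists_coeff.{w} hn
  have key : ∀ (f : Unc.{w} n →ₗ[ℂ] ℂ) (s : S) (P N : Fin n → Fin n → S),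
      TensorProduct.lid ℂ S ((f.comp (vnSubspace n).subtype).rTensor S (vTensor.{u, w} s P N)) =
        f 1 • s + ∑ i, ∑ j, f (Unc.u n i j) • P i j +
          ∑ i, ∑ j, f (star (Unc.u n j i)) • N i j := by
    intro f s P N
    simp only [vTensor, map_add, map_sum, LinearMap.rTensor_tmul, TensorProduct.lid_tmul]
    rfl
  refine ⟨?_, fun i j => ?_, fun i j => ?_⟩
  · have := congrArg (fun x => TensorProduct.lid ℂ S
      ((c₀.comp (vnSubspace n).subtype).rTensor S x)) h
    simpa [key, h₀, h₀u, h₀s] using this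
  · have := congrArg (fun x => TensorProduct.lid ℂ S
      (((c i j).comp (vnSubspace n).subtype).rTensor S x)) h
    simpa [key, (hc i j).1, (hc i j).2.1, (hc i j).2.2, ite_and] using this
  · have := congrArg (fun x => TensorProduct.lid ℂ S
      (((d j i).comp (vnSubspace n).subtype).rTensor S x)) h
    simpa [key, (hd j i).1, (hd j i).2.1, (hd j i).2.2, ite_and] using this

/-- The `(a, b)` entry `U_nc(n) ⊗ M_p(S) → U_nc(n) ⊗ S`. -/
def slice {n p : ℕ} (a b : Fin p) :
    Unc.{w} n ⊗[ℂ] Matrix (Fin p) (Fin p) S →ₗ[ℂ] Unc.{w} n ⊗[ℂ] S :=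
  (Matrix.entryLinearMap ℂ S a b).lTensor (Unc.{w} n)

theorem slice_tmul {n p : ℕ} (a b : Fin p) (x : Unc.{w} n) (Y : Matrix (Fin p) (Fin p) S) :
    slice a b (x ⊗ₜ[ℂ] Y) = x ⊗ₜ Y a b := rfl

theorem star_slice {n p : ℕ} (a b : Fin p) (y : Unc.{w} n ⊗[ℂ] Matrix (Fin p) (Fin p) S) :
    star (slice a b y) = slice b a (star y) := by
  induction y with
  | zero => simp
  | tmul x Y => simp only [slice_tmul, TensorProduct.star_tmul]; rfl
  | add y y' h h' => simp only [map_add, star_add, h, h']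

theorem slice_injective {n p : ℕ} {y y' : Unc.{w} n ⊗[ℂ] Matrix (Fin p) (Fin p) S}
    (h : ∀ a b, slice a b y = slice a b y') : y = y' := by
  have key : ∀ y : Unc.{w} n ⊗[ℂ] Matrix (Fin p) (Fin p) S,
      ∑ a, ∑ b, (Matrix.singleLinearMap ℂ a b).lTensor (Unc.{w} n) (slice a b y) = y := by
    intro y
    induction y with
    | zero => simp
    | tmul x Y =>
      simp only [slice_tmul, LinearMap.lTensor_tmul, ← TensorProduct.tmul_sum]
      congr 1
      exact (Matrix.matrix_eq_sum_single Y).symm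
    | add y y' h h' => simp only [map_add, Finset.sum_add_distrib, h, h']
  rw [← key y, ← key y']
  simp only [h]

/-- The inclusion of `V_n ⊗ S` into `U_nc(n) ⊗ S`. -/
def vnIncl (n : ℕ) : Vn.{w} n ⊗[ℂ] S →ₗ[ℂ] Unc.{w} n ⊗[ℂ] S :=
  (vnSubspace.{w} n).subtype.rTensor S

theorem vnIncl_tmul {n : ℕ} (x : Vn.{w} n) (s : S) : vnIncl n (x ⊗ₜ[ℂ] s) = (x : Unc n) ⊗ₜ s := rfl

theorem vnIncl_injective (n : ℕ) : Function.Injective (vnIncl.{u, w} (S := S) n) :=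
  Module.Flat.rTensor_preserves_injective_linearMap _ Subtype.val_injective

theorem star_vnIncl {n : ℕ} (x : Vn.{w} n ⊗[ℂ] S) : star (vnIncl n x) = vnIncl n (star x) := by
  induction x with
  | zero => simp
  | tmul v s => simp only [vnIncl_tmul, TensorProduct.star_tmul, Vn.coe_star]
  | add y y' h h' => simp only [map_add, star_add, h, h']

theorem kronMap_vnIncl {n : ℕ} {ι κ : Type*} [Fintype ι] [Fintype κ]
    (φ : Unc.{w} n →ₗ[ℂ] Matrix ι ι ℂ) (ψ : S →ₗ[ℂ] Matrix κ κ ℂ) (x : Vn.{w} n ⊗[ℂ] S) :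
    kronMap φ ψ (vnIncl n x) = kronMap (φ.comp (vnSubspace n).subtype) ψ x := by
  induction x with
  | zero => simp
  | tmul v s => rfl
  | add y y' h h' => simp only [map_add, h, h']

/-- The amplification `M_p(S) → M_p ⊗ M_l` of `ψ : S → M_l`. -/
def amplify (p : ℕ) {ι : Type*} (ψ : S →ₗ[ℂ] Matrix ι ι ℂ) :
    Matrix (Fin p) (Fin p) S →ₗ[ℂ] Matrix (Fin p × ι) (Fin p × ι) ℂ where
  toFun Y := Matrix.comp _ _ _ _ ℂ (Y.map ψ)
  map_add' Y Y' := by ext; simp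
  map_smul' c Y := by ext; simp

theorem IsCP.amplify {p : ℕ} {ι : Type*} [Fintype ι] {ψ : S →ₗ[ℂ] Matrix ι ι ℂ} (hψ : IsCP ψ) :
    IsCP (amplify p ψ) := by
  intro n X hX
  have hX' : IsPos (Matrix.comp _ _ _ _ S X) := hX
  exact (hψ.posSemidef_comp hX').submatrix fun x : Fin n × (Fin p × ι) => ((x.1, x.2.1), x.2.2)

theorem kronMap_amplify {n p : ℕ} {ι κ : Type*} [Fintype ι] [Fintype κ]
    (φ : Unc.{w} n →ₗ[ℂ] Matrix κ κ ℂ) (ψ : S →ₗ[ℂ] Matrix ι ι ℂ)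
    (y : Unc.{w} n ⊗[ℂ] Matrix (Fin p) (Fin p) S) (a b : Fin p) (x x' : κ × ι) :
    kronMap φ (amplify p ψ) y (x.1, (a, x.2)) (x'.1, (b, x'.2)) =
      kronMap φ ψ (slice a b y) x x' := by
  induction y with
  | zero => simp
  | tmul v s => rfl
  | add y y' h h' => simp only [map_add, Matrix.add_apply, h, h']

/-- The map `S → M_p ⊗ M_l` corresponding to `ψ : M_p(S) → M_l`: its `(a, b)` block is the
restriction of `ψ` to the `(a, b)` corner. -/
def corners {p : ℕ} {ι : Type*} (ψ : Matrix (Fin p) (Fin p) S →ₗ[ℂ] Matrix ι ι ℂ) :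
    S →ₗ[ℂ] Matrix (Fin p × ι) (Fin p × ι) ℂ where
  toFun s := Matrix.comp _ _ _ _ ℂ (Matrix.of fun a b => ψ (Matrix.single a b s))
  map_add' s s' := by ext; simp [Matrix.single_add]
  map_smul' c s := by ext; simp [← Matrix.smul_single]

theorem IsCP.corners {p : ℕ} {ι : Type*} [Fintype ι]
    {ψ : Matrix (Fin p) (Fin p) S →ₗ[ℂ] Matrix ι ι ℂ} (hψ : IsCP ψ) : IsCP (corners ψ) := by
  intro n X hX
  let Z : Matrix (Fin n × Fin p) (Fin n × Fin p) (Matrix (Fin p) (Fin p) S) :=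
    Matrix.of fun x y => Matrix.single x.2 y.2 (X x.1 y.1)
  have hZ : IsPos Z := by
    rw [isPos_comp_iff]
    have := (isPos_fin_iff.2 hX).compress (Matrix.of fun (i : Fin n)
      (x : (Fin n × Fin p) × Fin p) => if i = x.1.1 ∧ x.1.2 = x.2 then 1 else 0)
    convert this using 1
    ext ⟨⟨i, a⟩, a'⟩ ⟨⟨j, b⟩, b'⟩
    by_cases ha : a = a' <;> by_cases hb : b = b' <;>
      simp [Z, OpSys.compress, ha, hb, apply_ite]
  exact (hψ.posSemidef_comp hZ).submatrix fun x : Fin n × (Fin p × ι) => ((x.1, x.2.1), x.2.2)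

theorem kronMap_eq_sum_corners {n p : ℕ} {ι κ : Type*} [Fintype ι] [Fintype κ]
    (φ : Unc.{w} n →ₗ[ℂ] Matrix κ κ ℂ) (ψ : Matrix (Fin p) (Fin p) S →ₗ[ℂ] Matrix ι ι ℂ)
    (y : Unc.{w} n ⊗[ℂ] Matrix (Fin p) (Fin p) S) (x x' : κ × ι) :
    kronMap φ ψ y x x' =
      ∑ a, ∑ b, kronMap φ (corners ψ) (slice a b y) (x.1, (a, x.2)) (x'.1, (b, x'.2)) := by
  induction y with
  | zero => simp
  | tmul v Y =>
    change φ v x.1 x'.1 * ψ Y x.2 x'.2 =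
      ∑ a, ∑ b, φ v x.1 x'.1 * ψ (Matrix.single a b (Y a b)) x.2 x'.2
    conv_lhs => rw [Matrix.matrix_eq_sum_single Y]
    simp only [map_sum, Matrix.sum_apply, Finset.mul_sum]
  | add y y' h h' => simp only [map_add, Matrix.add_apply, h, h', Finset.sum_add_distrib]

/-- Positivity in `M_p(V_n ⊗_min S)` is positivity in `U_nc(n) ⊗_min M_p(S)`. -/
theorem mem_minCone_unc_iff {n p : ℕ} {y : Unc.{w} n ⊗[ℂ] Matrix (Fin p) (Fin p) S}
    {X : Matrix (Fin p) (Fin p) (Vn.{w} n ⊗[ℂ] S)} (hX : ∀ a b, slice a b y = vnIncl n (X a b)) :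
    (Matrix.of fun _ _ => y) ∈ minCone (Unc.{w} n) (Matrix (Fin p) (Fin p) S) 1 ↔
      X ∈ minCone (Vn.{w} n) S p := by
  have hs : (Matrix.of fun _ _ : Fin 1 => y).conjTranspose = (Matrix.of fun _ _ => y) ↔
      X.conjTranspose = X := by
    constructor
    · intro h
      have h' : star y = y := congrFun (congrFun h 0) 0
      ext a b
      refine vnIncl_injective n ?_
      rw [Matrix.conjTranspose_apply, ← star_vnIncl, ← hX, ← hX, star_slice, h']
    · intro h
      ext i j
      change star y = y
      refine slice_injective fun a b => ?_
      rw [← star_slice, hX, hX, star_vnIncl]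
      exact congrArg _ (congrFun (congrFun h a) b)
  constructor
  · refine fun h => ⟨hs.1 h.1, fun k l φ ψ hφ hψ => ?_⟩
    obtain ⟨θ, hθ, hθφ⟩ := Vn.exists_extension hφ
    have := (posSemidef_of_mem_minCone h hθ.isCP (hψ.isCP.amplify (p := p))).submatrix
      fun x : Fin p × (Fin k × Fin l) => ((0 : Fin 1), (x.2.1, (x.1, x.2.2)))
    convert this using 1
    ext ⟨a, x⟩ ⟨b, x'⟩
    change tensorMap φ ψ (X a b) x x' =
      kronMap θ (amplify p ψ) y (x.1, (a, x.2)) (x'.1, (b, x'.2))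
    have hφθ : θ.comp (vnSubspace n).subtype = φ := LinearMap.ext hθφ
    rw [kronMap_amplify, hX, kronMap_vnIncl, tensorMap_eq_kronMap, hφθ]
  · refine fun h => ⟨hs.2 h.1, fun k l φ ψ hφ hψ => ?_⟩
    have hφ' : IsCP (φ.comp (vnSubspace n).subtype) := fun m Z hZ =>
      hφ.2 m (Z.map (vnSubspace n).subtype) hZ
    have := posSemidef_sum_sum (posSemidef_of_mem_minCone h hφ' hψ.isCP.corners)
      fun (a : Fin p) (x : Fin 1 × (Fin k × Fin l)) => (a, (x.2.1, (a, x.2.2)))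
    convert this using 1
    ext ⟨i, x⟩ ⟨j, x'⟩
    change tensorMap φ ψ y x x' = ∑ a, ∑ b, kronMap (φ.comp (vnSubspace n).subtype) (corners ψ)
      (X a b) (x.1, (a, x.2)) (x'.1, (b, x'.2))
    rw [tensorMap_eq_kronMap, kronMap_eq_sum_corners]
    simp only [hX, kronMap_vnIncl]

theorem slice_vElement {n p : ℕ} (S₁₁ : Matrix (Fin p) (Fin p) S)
    (P N : Fin n → Fin n → Matrix (Fin p) (Fin p) S) (a b : Fin p) :
    slice a b (vElement.{u, w} S₁₁ P N) = vnIncl n (vTensor (S₁₁ a b)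
      (fun i j => (1 / (2 * n) : ℂ) • P i j a b) (fun i j => (1 / (2 * n) : ℂ) • N i j a b)) := by
  simp only [vElement, vTensor, map_add, map_sum, slice_tmul, vnIncl_tmul,
    TensorProduct.tmul_smul, TensorProduct.smul_tmul', Submodule.coe_smul, Vn.coe_unit,
    Vn.coe_u, Vn.coe_star]

end TensorVn

/-! ### Property `𝔙_n` and the tensor products of `V_n` -/

section Characterization

variable {S : Type u} [AddCommGroup S] [Module ℂ S] [StarAddMonoid S] [StarModule ℂ S]
  [OperatorSystem S]

theorem compress_kroneckerMap_comp {V : Type*} [AddCommGroup V] [Module ℂ V] {τ : Type*}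
    [Fintype τ] [DecidableEq τ] {m : ℕ} (P : Matrix τ τ V)
    (R : Matrix τ τ (Matrix (Fin m) (Fin m) S)) (a b : Fin m) :
    compress (Matrix.of fun (x : τ × (τ × Fin m)) (a : Fin m) =>
        if x.1 = x.2.1 ∧ a = x.2.2 then 1 else 0)
      (Matrix.kroneckerMap (fun s t => s ⊗ₜ[ℂ] t) P (Matrix.comp _ _ _ _ S R)) a b =
      ∑ i, ∑ j, P i j ⊗ₜ R i j a b := by
  simp [compress, Fintype.sum_prod_type, ite_and, apply_ite, ite_smul]

theorem sum_block_tmul {n : ℕ} (R : Matrix (Fin n ⊕ Fin n) (Fin n ⊕ Fin n) S) :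
    ∑ i, ∑ j, Vn.block.{w} n i j ⊗ₜ[ℂ] R i j =
      vTensor (∑ i, R i i) (fun i j => R (Sum.inl i) (Sum.inr j))
        fun i j => R (Sum.inr i) (Sum.inl j) := by
  have hd : ∀ f : Fin n → Fin n → S, ∑ i, ∑ j,
      (Matrix.diagonal (fun _ => unit) : Matrix (Fin n) (Fin n) (Vn.{w} n)) i j ⊗ₜ[ℂ] f i j =
      unit ⊗ₜ ∑ i, f i i := by
    intro f
    rw [TensorProduct.tmul_sum]
    refine Finset.sum_congr rfl fun i _ => ?_
    rw [Finset.sum_eq_single i]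
    · rw [Matrix.diagonal_apply_eq]
    · intro j _ hj
      rw [Matrix.diagonal_apply_ne _ hj.symm, TensorProduct.zero_tmul]
    · simp
  simp only [Fintype.sum_sum_type, Finset.sum_add_distrib, Vn.block, Matrix.fromBlocks_apply₁₁,
    Matrix.fromBlocks_apply₁₂, Matrix.fromBlocks_apply₂₁, Matrix.fromBlocks_apply₂₂,
    Matrix.of_apply, hd fun i j => R (Sum.inl i) (Sum.inl j),
    hd fun i j => R (Sum.inr i) (Sum.inr j), vTensor, TensorProduct.tmul_add]
  abel

theorem vTensor_zero_zero {n : ℕ} (s : S) :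
    vTensor.{u, w} s (0 : Fin n → Fin n → S) 0 = unit ⊗ₜ s := by
  simp [vTensor]

theorem smul_diagonal_unit_apply {V : Type*} [AddCommGroup V] [Module ℂ V] [StarAddMonoid V]
    [StarModule ℂ V] [OperatorSystem V] {p : ℕ} (c : ℂ) (a b : Fin p) :
    (c • Matrix.diagonal fun _ : Fin p => (unit : V) ⊗ₜ[ℂ] (unit : S)) a b =
      unit ⊗ₜ[ℂ] ((c • (unit : Matrix (Fin p) (Fin p) S)) a b) := by
  change c • Matrix.diagonal _ a b = unit ⊗ₜ[ℂ] (c • Matrix.diagonal (fun _ => (unit : S)) a b)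
  by_cases hab : a = b
  · subst hab
    simp only [Matrix.diagonal_apply_eq, TensorProduct.tmul_smul]
  · simp only [Matrix.diagonal_apply_ne _ hab, smul_zero, TensorProduct.tmul_zero]

/-- If `X` is positive in the minimal tensor product and `R` is provided by property `𝔙_n`, then
`X + ε 1 = (2n)⁻¹ ∑ b_{ij} ⊗ R_{ij}` for the positive block matrix `(b_{ij})` over `V_n`, and this
is of the form `A (P ⊗ Q) A^*`. -/
theorem minEqMax_of_hasPropertyVn {n : ℕ} (hn : 1 ≤ n) (h : HasPropertyVn.{u, w} S n) :
    MinEqMax (Vn.{w} n) S := by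
  refine fun m => Set.Subset.antisymm (fun X hX => ⟨hX.1, fun ε hε => ?_⟩)
    (maxCone_subset_minCone m)
  have hn0 : (2 * n : ℂ) ≠ 0 := by
    have : (n : ℂ) ≠ 0 := by exact_mod_cast (by omega : n ≠ 0)
    simpa using this
  have hc : ∀ s : S, (1 / (2 * n) : ℂ) • (2 * n : ℂ) • s = s := fun s => by
    rw [smul_smul, one_div_mul_cancel hn0, one_smul]
  choose s P N hXv using fun a b => exists_eq_vTensor (X a b)
  obtain ⟨R, hR, hRP, hRN, hRs⟩ := h m (Matrix.of s)
    (fun i j => Matrix.of fun a b => (2 * n : ℂ) • P a b i j)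
    (fun i j => Matrix.of fun a b => (2 * n : ℂ) • N a b i j)
    ((mem_minCone_unc_iff fun a b => by
      rw [slice_vElement, hXv]
      simp only [Matrix.of_apply, hc]).2 hX) ε hε
  have hmem := mem_maxPreCone
    ((Vn.isPos_block.{w} n).smul (t := 1 / (2 * n : ℝ)) (by positivity)) (isPos_comp_iff.1 hR)
    (Matrix.of fun (x : (Fin n ⊕ Fin n) × ((Fin n ⊕ Fin n) × Fin m)) (a : Fin m) =>
        if x.1 = x.2.1 ∧ a = x.2.2 then (1 : ℂ) else 0).conjTranspose
  rw [Matrix.conjTranspose_conjTranspose] at hmem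
  convert hmem using 1
  ext a b
  rw [compress_kroneckerMap_comp]
  have hs : ∑ i, R i i a b =
      (2 * n : ℂ) • (s a b + ((ε : ℂ) • (unit : Matrix (Fin m) (Fin m) S)) a b) := by
    have := congrFun (congrFun hRs a) b
    rwa [Matrix.sum_apply] at this
  have hsum : ∑ i, ∑ j, (((1 / (2 * n : ℝ) : ℝ) : ℂ) • Vn.block.{w} n) i j ⊗ₜ[ℂ] R i j a b =
      (1 / (2 * n) : ℂ) • ∑ i, ∑ j, Vn.block.{w} n i j ⊗ₜ[ℂ] R.map (fun Y => Y a b) i j := by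
    simp only [Finset.smul_sum, Matrix.smul_apply, TensorProduct.smul_tmul', Matrix.map_apply]
    push_cast
    rfl
  rw [hsum, sum_block_tmul, smul_vTensor]
  simp only [Matrix.map_apply, hRP, hRN, hs, Matrix.of_apply]
  have hc' : ∀ F : Fin n → Fin n → S, ((1 / (2 * n) : ℂ) • fun i j => (2 * n : ℂ) • F i j) = F :=
    fun F => by
      funext i j
      exact hc _
  have h1 := vTensor_add (s a b) (((ε : ℂ) • (unit : Matrix (Fin m) (Fin m) S)) a b) (P a b) 0
    (N a b) 0
  rw [add_zero, add_zero] at h1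
  rw [hc, hc', hc', h1, vTensor_zero_zero, ← hXv, Matrix.add_apply, smul_diagonal_unit_apply]

/-- If `X + ε 1 = A (P₀ ⊗ Q) A^*`, then lifting `P₀` to a positive scalar matrix `R₀` gives the
required positive matrix `A (R₀ ⊗ Q) A^*`, whose blocks are identified by comparing coefficients. -/
theorem hasPropertyVn_of_minEqMax {n : ℕ} (hn : 1 ≤ n) (h : MinEqMax (Vn.{w} n) S) :
    HasPropertyVn.{u, w} S n := by
  intro p S₁₁ P N hy ε hε
  have hn0 : (2 * n : ℂ) ≠ 0 := by
    have : (n : ℂ) ≠ 0 := by exact_mod_cast (by omega : n ≠ 0)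
    simpa using this
  have hc : ∀ s : S, ((2 * n : ℝ) : ℂ) • (1 / (2 * n) : ℂ) • s = s := fun s => by
    push_cast
    rw [smul_smul, mul_one_div_cancel hn0, one_smul]
  have hX := (mem_minCone_unc_iff (X := Matrix.of fun a b => vTensor (S₁₁ a b)
    (fun i j => (1 / (2 * n) : ℂ) • P i j a b) (fun i j => (1 / (2 * n) : ℂ) • N i j a b))
    (slice_vElement S₁₁ P N)).1 hy
  rw [h p] at hX
  obtain ⟨k, m, P₀, Q, A, hP₀, hQ, hX⟩ := hX.2 ε hε
  obtain ⟨R₀, hR₀, hR₀P⟩ := Vn.exists_posSemidef_lift hn hP₀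
  -- the matrix `A (R₀ ⊗ Q) A^*`; the factor `2n` comes from the normalisation of `vElement`
  let R₁ : Matrix (Fin n ⊕ Fin n) (Fin n ⊕ Fin n) (Matrix (Fin p) (Fin p) S) :=
    Matrix.of fun i j => Matrix.of fun a b => ∑ x : Fin k × Fin m, ∑ y : Fin k × Fin m,
      (A a x * star (A b y)) •
        R₀ ((Equiv.sumProdDistrib _ _ _) (i, x.1)) ((Equiv.sumProdDistrib _ _ _) (j, y.1)) •
          Q x.2 y.2
  have hR₁ : IsPos R₁ := by
    rw [isPos_comp_iff]
    have := ((isPos_fin_iff.2 hQ).scalar_kronecker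
      (hR₀.submatrix (Equiv.sumProdDistrib (Fin n) (Fin n) (Fin k)))).compress
      (Matrix.of fun (x : ((Fin n ⊕ Fin n) × Fin k) × Fin m) (a : (Fin n ⊕ Fin n) × Fin p) =>
        if x.1.1 = a.1 then star (A a.2 (x.1.2, x.2)) else 0)
    convert this using 1
    ext ⟨i, a⟩ ⟨j, b⟩
    simp only [compress, Matrix.of_apply, Matrix.kroneckerMap_apply, Matrix.submatrix_apply,
      Matrix.comp_apply, R₁]
    simp [Fintype.sum_prod_type, ite_smul, apply_ite]
  have hcoef : ∀ a b,
      (∑ i, R₁ i i a b = S₁₁ a b + ((ε : ℂ) • (unit : Matrix (Fin p) (Fin p) S)) a b) ∧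
      (∀ i j, R₁ (Sum.inl i) (Sum.inr j) a b = (1 / (2 * n) : ℂ) • P i j a b) ∧
      ∀ i j, R₁ (Sum.inr i) (Sum.inl j) a b = (1 / (2 * n) : ℂ) • N i j a b := by
    intro a b
    have hXab := congrFun (congrFun hX a) b
    rw [Matrix.add_apply, smul_diagonal_unit_apply, Matrix.of_apply, ← vTensor_zero_zero,
      ← vTensor_add] at hXab
    simp only [add_zero, compress, Matrix.of_apply, Matrix.kroneckerMap_apply, hR₀P,
      tmul_eq_vTensor, smul_vTensor, sum_vTensor] at hXab
    obtain ⟨h1, h2, h3⟩ := vTensor_injective hn hXab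
    refine ⟨h1.symm ▸ ?_, fun i j => ?_, fun i j => ?_⟩
    · simp only [R₁, Matrix.of_apply, Matrix.conjTranspose_apply, star_star]
      rw [Finset.sum_comm]
      refine Finset.sum_congr rfl fun x _ => ?_
      rw [Finset.sum_comm]
      refine Finset.sum_congr rfl fun y _ => ?_
      rw [← Finset.smul_sum, ← Finset.sum_smul, Fintype.sum_sum_type, ← Finset.sum_add_distrib]
      rfl
    · rw [h2]
      simp [R₁]
    · rw [h3]
      simp [R₁]
  refine ⟨((2 * n : ℝ) : ℂ) • R₁, hR₁.smul (by positivity), fun i j => ?_, fun i j => ?_, ?_⟩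
  · ext a b
    rw [Matrix.smul_apply, Matrix.smul_apply, (hcoef a b).2.1, hc]
  · ext a b
    rw [Matrix.smul_apply, Matrix.smul_apply, (hcoef a b).2.2, hc]
  · ext a b
    rw [Matrix.sum_apply]
    simp only [Matrix.smul_apply, ← Finset.smul_sum, (hcoef a b).1, Matrix.add_apply]
    push_cast
    rfl

end Characterization

/-! ### Nuclearity and change of universe -/

section Transport

section Structure

variable {V : Type*} [AddCommGroup V] [Module ℂ V] [StarAddMonoid V] [StarModule ℂ V]
variable {T : Type*} [AddCommGroup T] [Module ℂ T] (e : V ≃ₗ[ℂ] T)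

/-- The involution on `T` obtained from the one on `V` along a linear isomorphism. -/
abbrev transportStarAddMonoid : StarAddMonoid T where
  star t := e (star (e.symm t))
  star_involutive t := by simp
  star_add t t' := by simp

theorem transportStarModule :
    letI := transportStarAddMonoid e
    StarModule ℂ T :=
  letI := transportStarAddMonoid e
  { star_smul := fun c t => by
      change e (star (e.symm (c • t))) = star c • e (star (e.symm t))
      simp }

theorem map_compress {V W : Type*} [AddCommGroup V] [Module ℂ V] [AddCommGroup W] [Module ℂ W]
    {ι κ : Type*} [Fintype ι] (f : V →ₗ[ℂ] W) (A : Matrix ι κ ℂ) (X : Matrix ι ι V) :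
    (compress A X).map f = compress A (X.map f) := by
  ext i j
  simp [compress]

variable [OperatorSystem V]

/-- The operator system structure on `T` obtained from the one on `V` along a linear
isomorphism. -/
abbrev transportSystem :
    letI := transportStarAddMonoid e
    haveI := transportStarModule e
    OperatorSystem T :=
  letI := transportStarAddMonoid e
  haveI := transportStarModule e
  have hunit : ∀ (n : ℕ) (r : ℝ) (X : Matrix (Fin n) (Fin n) T),
      (X + (r : ℂ) • Matrix.diagonal (fun _ => e unit)).map e.symm =
        X.map e.symm + (r : ℂ) • Matrix.diagonal (fun _ => (unit : V)) := fun n r X => by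
    ext i j
    by_cases hij : i = j
    · subst hij
      simp [-Complex.coe_smul]
    · simp [hij]
  have hinj : ∀ (n : ℕ) (X Y : Matrix (Fin n) (Fin n) T), X.map e.symm = Y.map e.symm → X = Y :=
    fun n X Y h => by
      ext i j
      exact e.symm.injective (congrFun (congrFun h i) j)
  have hstar : ∀ (n : ℕ) (X : Matrix (Fin n) (Fin n) T),
      X.conjTranspose.map e.symm = (X.map e.symm).conjTranspose := fun n X => by
    ext i j
    exact e.symm_apply_apply _
  { cone := fun n => {X | X.map e.symm ∈ cone n}
    unit := e unit
    conjTranspose_eq := fun {n X} h => hinj _ _ _ <| by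
      rw [hstar]
      exact OperatorSystem.conjTranspose_eq h
    add_mem := fun {n X Y} h h' => by
      have : (X + Y).map e.symm = X.map e.symm + Y.map e.symm := by ext; simp
      rw [Set.mem_ofPred_eq, this]
      exact OperatorSystem.add_mem h h'
    smul_mem := fun {n X t} ht h => by
      have : ((t : ℂ) • X).map e.symm = (t : ℂ) • X.map e.symm := by
        ext
        simp [-Complex.coe_smul]
      rw [Set.mem_ofPred_eq, this]
      exact OperatorSystem.smul_mem ht h
    compress_mem := fun {n m} A {X} h => by
      have : (compress A X).map e.symm = compress A (X.map e.symm) :=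
        map_compress (e.symm : T →ₗ[ℂ] V) A X
      rw [Set.mem_ofPred_eq, this]
      exact OperatorSystem.compress_mem A h
    eq_zero := fun {n X} h h' => hinj _ _ _ <| by
      have : (-X).map e.symm = -X.map e.symm := by ext; simp
      rw [Set.mem_ofPred_eq, this] at h'
      rw [OperatorSystem.eq_zero h h']
      ext
      simp
    star_unit := by
      change e (star (e.symm (e unit))) = e unit
      rw [e.symm_apply_apply, star_unit]
    exists_add_mem := fun {n} X hX => by
      obtain ⟨r, hr, h⟩ := exists_add_mem (X.map e.symm) (by rw [← hstar, hX])
      rw [← hunit] at h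
      exact ⟨r, hr, h⟩
    archimedean := fun {n} X hX h => by
      refine OperatorSystem.archimedean (X.map e.symm) (by rw [← hstar, hX]) fun r hr => ?_
      rw [← hunit]
      exact h r hr }

end Structure

section Swap

variable {V : Type*} [AddCommGroup V] [Module ℂ V] [StarAddMonoid V] [StarModule ℂ V]
  [OperatorSystem V]
variable {T : Type*} [AddCommGroup T] [Module ℂ T] [StarAddMonoid T] [StarModule ℂ T]
  [OperatorSystem T]
variable {S : Type*} [AddCommGroup S] [Module ℂ S] [StarAddMonoid S] [StarModule ℂ S]
  [OperatorSystem S]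

/-- Equality of the minimal and maximal cones is invariant under the flip and under complete order
isomorphisms. -/
theorem MinEqMax.swap (e : V ≃ₗ[ℂ] T) (hstar : ∀ x, e (star x) = star (e x))
    (hunit : e unit = unit)
    (hcone : ∀ (n : ℕ) (X : Matrix (Fin n) (Fin n) V), X ∈ cone n ↔ X.map e ∈ cone n)
    (h : MinEqMax S T) : MinEqMax V S := by
  let σ : V ⊗[ℂ] S ≃ₗ[ℂ] S ⊗[ℂ] T :=
    (TensorProduct.congr e (LinearEquiv.refl ℂ S)).trans (TensorProduct.comm ℂ T S)
  have hσ : ∀ v s, σ (v ⊗ₜ s) = s ⊗ₜ e v := fun _ _ => rfl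
  have hσ' : ∀ t s, σ.symm (s ⊗ₜ t) = e.symm t ⊗ₜ s := fun _ _ => rfl
  have hσs : ∀ x, σ (star x) = star (σ x) := by
    intro x
    induction x with
    | zero => simp
    | tmul v s => simp only [TensorProduct.star_tmul, hσ, hstar]
    | add x y hx hy => simp only [star_add, map_add, hx, hy]
  refine fun n => Set.Subset.antisymm (fun X hX => ?_) (maxCone_subset_minCone n)
  have h1 : X.map σ ∈ minCone S T n := by
    refine ⟨?_, fun k l φ ψ hφ hψ => ?_⟩
    · ext i j
      rw [Matrix.conjTranspose_apply, Matrix.map_apply, ← hσs]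
      exact congrArg σ (congrFun (congrFun hX.1 i) j)
    · have hψ' : IsMatrixState (ψ.comp (e : V →ₗ[ℂ] T)) := by
        refine ⟨?_, fun m Z hZ => hψ.2 m (Z.map e) ((hcone m Z).1 hZ)⟩
        rw [LinearMap.comp_apply, LinearEquiv.coe_coe, hunit, hψ.1]
      have := (hX.2 l k _ φ hψ' hφ).submatrix fun x : Fin n × (Fin k × Fin l) => (x.1, x.2.swap)
      convert this using 1
      ext ⟨i, x⟩ ⟨j, y⟩
      have key : ∀ z : V ⊗[ℂ] S, tensorMap φ ψ (σ z) x y =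
          tensorMap (ψ.comp (e : V →ₗ[ℂ] T)) φ z x.swap y.swap := by
        intro z
        induction z with
        | zero => simp
        | tmul v s => exact mul_comm _ _
        | add z z' hz hz' => simp only [map_add, Matrix.add_apply, hz, hz']
      exact key (X i j)
  rw [h n] at h1
  refine ⟨hX.1, fun ε hε => ?_⟩
  obtain ⟨k, m, P, Q, A, hP, hQ, hPQ⟩ := h1.2 ε hε
  have hQ' : Q.map e.symm ∈ cone m := by
    rw [hcone]
    convert hQ using 1
    ext
    simp
  refine ⟨m, k, Q.map e.symm, P, A.submatrix id (Equiv.prodComm _ _), hQ', hP, ?_⟩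
  have h2 : (X + (ε : ℂ) • Matrix.diagonal fun _ => (unit : V) ⊗ₜ[ℂ] (unit : S)).map σ =
      X.map σ + (ε : ℂ) • Matrix.diagonal fun _ => (unit : S) ⊗ₜ[ℂ] (unit : T) := by
    ext i j
    by_cases hij : i = j
    · subst hij
      simp [hσ, hunit, -Complex.coe_smul]
    · simp [hij]
  rw [← h2] at hPQ
  ext i j
  refine σ.injective ((congrFun (congrFun hPQ i) j).trans ?_)
  simp only [compress, Matrix.of_apply, map_sum, map_smul, Matrix.kroneckerMap_apply, hσ,
    Matrix.map_apply, e.apply_symm_apply, Matrix.conjTranspose_apply, Matrix.submatrix_apply, id,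
    Fintype.sum_prod_type, Equiv.prodComm_apply, Prod.swap_prod_mk]
  rw [Finset.sum_comm]
  refine Finset.sum_congr rfl fun _ _ => Finset.sum_congr rfl fun _ _ => Finset.sum_comm

end Swap

instance (n : ℕ) : FiniteDimensional ℂ (Vn.{w} n) := by
  refine FiniteDimensional.span_of_finite ℂ ?_
  exact ((Set.finite_singleton _).union (Set.finite_range _)).union (Set.finite_range _)

/-- A nuclear operator system is tested on operator systems in `Type v`; the finite-dimensional
operator system `V_n` has a copy there. -/
theorem IsMinMaxNuclear.minEqMax_Vn {S : Type u} [AddCommGroup S] [Module ℂ S] [StarAddMonoid S]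
    [StarModule ℂ S] [OperatorSystem S] (h : IsMinMaxNuclear.{u, v} S) (n : ℕ) :
    MinEqMax (Vn.{w} n) S := by
  let T : Type v := ULift.{v} (Fin (Module.finrank ℂ (Vn.{w} n)) → ℂ)
  let e : Vn.{w} n ≃ₗ[ℂ] T :=
    (Module.finBasis ℂ (Vn.{w} n)).equivFun.trans ULift.moduleEquiv.symm
  let i₁ : StarAddMonoid T := transportStarAddMonoid e
  have i₂ : StarModule ℂ T := transportStarModule e
  let i₃ : OperatorSystem T := transportSystem e
  refine MinEqMax.swap e (fun x => ?_) rfl (fun m X => ?_) (h T)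
  · change e (star x) = e (star (e.symm (e x)))
    rw [e.symm_apply_apply]
  · change X ∈ cone m ↔ (X.map e).map e.symm ∈ cone m
    have : (X.map e).map e.symm = X := by
      ext
      simp
    rw [this]

end Transport

end OpSys

end

theorem mainTheorem11 (S : Type u) [AddCommGroup S] [Module ℂ S] [StarAddMonoid S]
    [StarModule ℂ S] [OpSys.OperatorSystem S] :
    (∀ n : ℕ, 1 ≤ n →
      (OpSys.HasPropertyVn.{u, w} S n ↔ OpSys.MinEqMax (OpSys.Vn.{w} n) S)) ∧
    (OpSys.IsMinMaxNuclear.{u, v} S → OpSys.HasPropertyV.{u, w} S) := by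
  have h : ∀ n : ℕ, 1 ≤ n →
      (OpSys.HasPropertyVn.{u, w} S n ↔ OpSys.MinEqMax (OpSys.Vn.{w} n) S) := fun n hn =>
    ⟨OpSys.minEqMax_of_hasPropertyVn hn, OpSys.hasPropertyVn_of_minEqMax hn⟩
  exact ⟨h, fun hS n hn => (h n hn).2 (hS.minEqMax_Vn n)⟩
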